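/- Throughout $m\ge 1$ is an integer. The first Heisenberg group $\mathbb H^1$ is $\mathbb R^3$ with points $(x,y,t)$ and group law $(x,y,t)(x',y',t')=(x+x',\,y+y',\,t+t'+2(yx'-xy'))$. Its horizontal vector fields are $X=\partial_x+2y\,\partial_t$ and $Y=\partial_y-2x\,\partial_t$. A curve $\gamma:\mathbb R\to\mathbb H^1$ is horizontal if it is absolutely continuous on every compact interval and $\gamma'(s)\in\operatorname{span}\{X(\gamma(s)),Y(\gamma(s))\}$ for almost every $s$. Let $K\subset\mathbb R$ be compact. A jet of order $m$ on $K$ is a family $F=(F^k)_{k=0}^m$ of continuous functions $F^k:K\to\mathbb R$; write $F=F^0$. For $a\in K$ put $T_aF(x)=\sum_{k=0}^m\frac{F^k(a)}{k!}(x-a)^k$. The jet $F$ is a Whitney field of class $C^m$ on $K$ if for every $0\le k\le m$ $$F^k(b)-\sum_{\ell=0}^{m-k}\frac{F^{k+\ell}(a)}{\ell!}(b-a)^\ell=o(|a-b|^{m-k})\quad\text{as }|a-b|\to0,\ a,b\in K,$$ uniformly in $a,b$. For $k\ge1$ let $\mathcal P^k$ be the polynomial obtained by differentiating $2(f'g-g'f)$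 $k-1$ times with the Leibniz rule: $$\mathcal P^k(x_0,y_0,\dots,x_k,y_k)=2\sum_{i=0}^{k-1}\binom{k-1}{i}\left(x_{i+1}y_{k-1-i}-y_{i+1}x_{k-1-i}\right).$$ For jets $F,G,H$ of order $m$ on $K$ and $a,b\in K$ with $a<b$ define $$A(a,b)=H(b)-H(a)-2\int_a^b\big((T_aF)'\,T_aG-(T_aG)'\,T_aF\big)+2F(a)\big(G(b)-T_aG(b)\big)-2G(a)\big(F(b)-T_aF(b)\big),$$ $$V(a,b)=(b-a)^{2m}+(b-a)^m\int_a^b\big(|(T_aF)'|+|(T_aG)'|\big).$$ **Theorem.** Let $K\subset\mathbb R$ be compact and let $F,G,H$ be jets of order $m\ge 1$ on $K$. There is a $C^m$ horizontal curve $(f,g,h):\mathbb R\to\mathbb H^1$ with $D^kf(x)=F^k(x)$, $D^kg(x)=G^k(x)$ and $D^kh(x)=H^k(x)$ for all $x\in K$ and $0\le k\le m$ if and only if 1. $F$, $G$ and $H$ are Whitney fields of class $C^m$ on $K$; 2. $H^k(t)=\mathcal P^k\big(F^0(t),G^0(t),F^1(t),G^1(t),\dots,F^k(t),G^k(t)\big)$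 for all $1\le k\le m$ and $t\in K$; 3. $A(a,b)/V(a,b)\to0$ uniformly as $(b-a)\searrow0$ with $a,b\in K$, i.e. for every $\varepsilon>0$ there is $\delta>0$ such that $|A(a,b)/V(a,b)|<\varepsilon$ for all $a,b\in K$ with $0<b-a<\delta$. -/

import Mathlib

noncomputable section

namespace HeisWhitney

/-- The underlying space `ℝ³` of the first Heisenberg group `ℍ¹`, with points `(x, y, t)`. The group
law is `(x, y, t) (x', y', t') = (x + x', y + y', t + t' + 2 (y x' - x y'))`; the left invariant
vector fields that span its horizontal layer are `fieldX` and `fieldY` below. -/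
abbrev Heis : Type := ℝ × ℝ × ℝ

/-- The left invariant vector field `X = ∂_x + 2 y ∂_t`. -/
def fieldX (p : Heis) : Heis := (1, 0, 2 * p.2.1)

/-- The left invariant vector field `Y = ∂_y - 2 x ∂_t`. -/
def fieldY (p : Heis) : Heis := (0, 1, -2 * p.1)

/-- `v` is horizontal at `p`: a linear combination of `X(p)` and `Y(p)`. -/
def IsHorizontalAt (p v : Heis) : Prop :=
  v ∈ Submodule.span ℝ ({fieldX p, fieldY p} : Set Heis)

/-- A curve `γ : ℝ → ℍ¹` is horizontal if it is absolutely continuous (on every compact interval)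
and `γ'(t)` is horizontal at `γ(t)` for almost every `t`. -/
def IsHorizontalCurve (γ : ℝ → Heis) : Prop :=
  (∀ a b : ℝ, AbsolutelyContinuousOnInterval γ a b) ∧
    ∀ᵐ t : ℝ, IsHorizontalAt (γ t) (deriv γ t)

/-- `F = (F⁰, …, Fᵐ)` is a jet of order `m` on `K`: each `Fᵏ`, `0 ≤ k ≤ m`, is continuous on `K`.
Only the values `F k x` with `k ≤ m` and `x ∈ K` are meaningful. -/
def IsJet (m : ℕ) (K : Set ℝ) (F : ℕ → ℝ → ℝ) : Prop :=
  ∀ k ≤ m, ContinuousOn (F k) K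

/-- The Taylor polynomial `T_a^m F (x) = ∑_{k=0}^m F^k(a) / k! (x - a)^k`. -/
def taylorPoly (m : ℕ) (F : ℕ → ℝ → ℝ) (a : ℝ) : Polynomial ℝ :=
  ∑ k ∈ Finset.range (m + 1),
    Polynomial.C (F k a / (k.factorial : ℝ)) * (Polynomial.X - Polynomial.C a) ^ k

/-- The remainder `(R_a^m F)^k (x) = F^k(x) - ∑_{ℓ=0}^{m-k} F^{k+ℓ}(a) / ℓ! (x - a)^ℓ`, `k ≤ m`. -/
def remainder (m : ℕ) (F : ℕ → ℝ → ℝ) (a : ℝ) (k : ℕ) (x : ℝ) : ℝ :=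
  F k x - ∑ l ∈ Finset.range (m - k + 1), F (k + l) a / (l.factorial : ℝ) * (x - a) ^ l

/-- The jet `F` is a Whitney field of class `C^m` on `K`: for every `0 ≤ k ≤ m`,
`(R_a^m F)^k (b) = o(|a - b|^{m-k})` as `|a - b| → 0` with `a, b ∈ K`. -/
def IsWhitneyField (m : ℕ) (K : Set ℝ) (F : ℕ → ℝ → ℝ) : Prop :=
  ∀ k ≤ m, ∀ ε : ℝ, 0 < ε → ∃ δ : ℝ, 0 < δ ∧ ∀ a ∈ K, ∀ b ∈ K, |a - b| < δ →
    |remainder m F a k b| ≤ ε * |a - b| ^ (m - k)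

/-- The polynomial `𝒫^k`, `k ≥ 1`, in the variables `x_j = X (inl j)` and `y_j = X (inr j)` that
stand for `D^j f` and `D^j g`. It is the `(k-1)`-st derivative of `2 (f' g - g' f)` expanded by
the Leibniz rule:
`2 ∑_{i=0}^{k-1} (k-1 choose i) (x_{i+1} y_{k-1-i} - y_{i+1} x_{k-1-i})`. -/
def horizPoly (k : ℕ) : MvPolynomial (ℕ ⊕ ℕ) ℝ :=
  MvPolynomial.C 2 * ∑ i ∈ Finset.range k, MvPolynomial.C ((k - 1).choose i : ℝ) *
    (MvPolynomial.X (Sum.inl (i + 1)) * MvPolynomial.X (Sum.inr (k - 1 - i)) -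
      MvPolynomial.X (Sum.inr (i + 1)) * MvPolynomial.X (Sum.inl (k - 1 - i)))

/-- The area discrepancy `A(a, b)`. -/
def areaDiscrepancy (m : ℕ) (F G H : ℕ → ℝ → ℝ) (a b : ℝ) : ℝ :=
  H 0 b - H 0 a
    - 2 * (∫ x in a..b,
        ((taylorPoly m F a).derivative.eval x * (taylorPoly m G a).eval x
          - (taylorPoly m G a).derivative.eval x * (taylorPoly m F a).eval x))
    + 2 * F 0 a * (G 0 b - (taylorPoly m G a).eval b)
    - 2 * G 0 a * (F 0 b - (taylorPoly m F a).eval b)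

/-- The velocity `V(a, b)`; it is positive when `a < b`. -/
def velocity (m : ℕ) (F G : ℕ → ℝ → ℝ) (a b : ℝ) : ℝ :=
  (b - a) ^ (2 * m) + (b - a) ^ m *
    (∫ x in a..b,
      (|(taylorPoly m F a).derivative.eval x| + |(taylorPoly m G a).derivative.eval x|))

/-- The triple `(F, G, H)` extends to the `C^m` horizontal curve `(f, g, h) : ℝ → ℍ¹`. -/
def ExtendsTo (m : ℕ) (K : Set ℝ) (F G H : ℕ → ℝ → ℝ) (f g h : ℝ → ℝ) : Prop :=
  ContDiff ℝ m (fun t => ((f t, g t, h t) : Heis)) ∧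
  IsHorizontalCurve (fun t => ((f t, g t, h t) : Heis)) ∧
  ∀ k ≤ m, ∀ x ∈ K,
    iteratedDeriv k f x = F k x ∧ iteratedDeriv k g x = G k x ∧ iteratedDeriv k h x = H k x

end HeisWhitney

end

/-!
A curve `(f, g, h)` is horizontal exactly when `h` rises by twice the area swept out by the plane
curve `(f, g)`. Replacing `f` and `g` by their Taylor polynomials at `a` changes the area over
`[a, b]` by the boundary terms in `A(a, b)`, up to an error controlled by the Taylor remainders and
the length of the Taylor curve, that is, by `o(V(a, b))`. This gives the necessity of the
conditions.

Conversely, over each gap `[a, b]` of `K`, rescaled to `[0, 1]`, the Taylor polynomials at `a` are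
corrected by Hermite interpolation so that their jets match at `b`, and then by polynomials that are
flat at both endpoints so that the swept area becomes `(H b - H a) / 2`. If the Taylor curve is no
longer than `(b - a) ^ m`, both components are corrected, and the area changes quadratically in the
size of the correction. Otherwise only the component other than the faster one, say `P`, is
corrected, by a multiple of `w P'` with a weight `w`; the area then changes linearly, at a rate
comparable to the speed of `P` because all norms on polynomials of bounded degree are equivalent.
In both cases the bound on `A / V` keeps the derivatives of order `m` under control, so that the
arcs glue to `C^m` functions, whose horizontal lift takes the prescribed values on `K`.
-/

namespace HeisWhitney

open Polynomial Set Filter Topology Asymptotics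
open scoped Uniformity

/-- The filter on pairs `(a, b)` of points of `K` with `a < b` along which `b - a` tends to `0`. -/
def shortIntervals (K : Set ℝ) : Filter (ℝ × ℝ) :=
  𝓤 ℝ ⊓ 𝓟 {p | p.1 ∈ K ∧ p.2 ∈ K ∧ p.1 < p.2}

lemma eventually_shortIntervals {K : Set ℝ} {P : ℝ → ℝ → Prop} :
    (∀ᶠ p in shortIntervals K, P p.1 p.2) ↔
      ∃ δ : ℝ, 0 < δ ∧ ∀ a ∈ K, ∀ b ∈ K, a < b → b - a < δ → P a b := by
  rw [shortIntervals, (Metric.uniformity_basis_dist.inf_principal _).eventually_iff]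
  refine exists_congr fun δ => and_congr_right fun _ => ⟨fun h a ha b hb hab hδ => ?_, ?_⟩
  · refine h (x := (a, b)) ⟨?_, ha, hb, hab⟩
    rwa [mem_ofPred_eq, dist_comm, Real.dist_eq, abs_of_pos (sub_pos.2 hab)]
  · rintro h ⟨a, b⟩ ⟨hδ, ha, hb, hab⟩
    refine h a ha b hb hab ?_
    rwa [mem_ofPred_eq, dist_comm, Real.dist_eq, abs_of_pos (sub_pos.2 hab)] at hδ

lemma eventually_mem_shortIntervals (K : Set ℝ) :
    ∀ᶠ p in shortIntervals K, p.1 ∈ K ∧ p.2 ∈ K ∧ p.1 < p.2 :=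
  mem_inf_of_right (mem_principal_self _)

lemma eventually_const_mul_le {η : ℝ} (hη : 0 < η) (c : ℝ) : ∀ᶠ ε in 𝓝[>] (0 : ℝ), c * ε ≤ η := by
  have h : Tendsto (fun ε : ℝ => c * ε) (𝓝[>] 0) (𝓝 0) := by
    simpa using (continuous_const_mul c).continuousWithinAt (s := Ioi 0) (x := 0) |>.tendsto
  exact h.eventually_le_const hη

/-! ### Swept area and length of plane curves -/

/-- Twice the signed area swept out, clockwise, by the position vector of the plane curve `(f, g)`
over `[a, b]`; a horizontal lift of `(f, g)` rises by twice this quantity. -/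
noncomputable def sweptArea (f g : ℝ → ℝ) (a b : ℝ) : ℝ :=
  ∫ x in a..b, (deriv f x * g x - deriv g x * f x)

/-- The length over `[a, b]` of the plane curve `(f, g)` with respect to the `ℓ¹` norm. -/
noncomputable def pathLength (f g : ℝ → ℝ) (a b : ℝ) : ℝ :=
  ∫ x in a..b, (|deriv f x| + |deriv g x|)

section SweptArea

variable {f g φ ψ : ℝ → ℝ} {a b M N : ℝ}

lemma sweptArea_swap (f g : ℝ → ℝ) (a b : ℝ) : sweptArea g f a b = -sweptArea f g a b := by
  simp [sweptArea, ← intervalIntegral.integral_neg]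

lemma pathLength_nonneg (f g : ℝ → ℝ) (hab : a ≤ b) : 0 ≤ pathLength f g a b :=
  intervalIntegral.integral_nonneg hab fun _ _ => by positivity

lemma continuous_areaForm (hf : ContDiff ℝ 1 f) (hg : ContDiff ℝ 1 g) :
    Continuous fun x => deriv f x * g x - deriv g x * f x := by
  have := hf.continuous
  have := hg.continuous
  have := hf.continuous_deriv_one
  have := hg.continuous_deriv_one
  fun_prop

lemma hasDerivAt_sweptArea (hf : ContDiff ℝ 1 f) (hg : ContDiff ℝ 1 g) (a x : ℝ) :
    HasDerivAt (sweptArea f g a) (deriv f x * g x - deriv g x * f x) x :=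
  (continuous_areaForm hf hg).integral_hasStrictDerivAt a x |>.hasDerivAt

/-- The mixed terms are integrated by parts so that no derivative of `(φ, ψ)` is left in them. -/
lemma sweptArea_add (hf : ContDiff ℝ 1 f) (hg : ContDiff ℝ 1 g) (hφ : ContDiff ℝ 1 φ)
    (hψ : ContDiff ℝ 1 ψ) (a b : ℝ) :
    sweptArea (f + φ) (g + ψ) a b = sweptArea f g a b
      + 2 * (∫ x in a..b, (deriv f x * ψ x - deriv g x * φ x))
      + ((φ b * g b - ψ b * f b) - (φ a * g a - ψ a * f a)) + sweptArea φ ψ a b := by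
  have df := hf.differentiable_one
  have dg := hg.differentiable_one
  have dφ := hφ.differentiable_one
  have dψ := hψ.differentiable_one
  have := hf.continuous_deriv_one
  have := hg.continuous_deriv_one
  have := hφ.continuous_deriv_one
  have := hψ.continuous_deriv_one
  have := hφ.continuous
  have := hψ.continuous
  have := hf.continuous
  have := hg.continuous
  have parts : ∫ x in a..b, ((deriv φ x * g x + φ x * deriv g x)
      - (deriv ψ x * f x + ψ x * deriv f x)) = (φ b * g b - ψ b * f b) - (φ a * g a - ψ a * f a) :=
    intervalIntegral.integral_eq_sub_of_hasDerivAt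
      (fun x _ => ((dφ x).hasDerivAt.mul (dg x).hasDerivAt).sub
        ((dψ x).hasDerivAt.mul (df x).hasDerivAt))
      (Continuous.intervalIntegrable (by fun_prop) _ _)
  rw [← parts, sweptArea, sweptArea, sweptArea, ← intervalIntegral.integral_const_mul,
    ← intervalIntegral.integral_add, ← intervalIntegral.integral_add,
    ← intervalIntegral.integral_add]
  · refine intervalIntegral.integral_congr fun x _ => ?_
    simp only [deriv_add (df x) (dφ x), deriv_add (dg x) (dψ x), Pi.add_apply]
    ring
  all_goals exact Continuous.intervalIntegrable (by fun_prop) _ _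

lemma abs_sub_add_abs_sub_le_pathLength (hf : ContDiff ℝ 1 f) (hg : ContDiff ℝ 1 g) (hab : a ≤ b) :
    |f b - f a| + |g b - g a| ≤ pathLength f g a b := by
  have variation {u : ℝ → ℝ} (hu : ContDiff ℝ 1 u) : |u b - u a| ≤ ∫ x in a..b, |deriv u x| := by
    rw [← intervalIntegral.integral_deriv_eq_sub (fun x _ => hu.differentiable_one x)
      (hu.continuous_deriv_one.intervalIntegrable a b)]
    exact intervalIntegral.abs_integral_le_integral_abs hab
  rw [pathLength, intervalIntegral.integral_add
    (hf.continuous_deriv_one.abs.intervalIntegrable _ _)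
    (hg.continuous_deriv_one.abs.intervalIntegrable _ _)]
  exact add_le_add (variation hf) (variation hg)

lemma abs_integral_le_mul_pathLength (hf : ContDiff ℝ 1 f) (hg : ContDiff ℝ 1 g) (hab : a ≤ b)
    (hφ : ∀ x ∈ Icc a b, |φ x| ≤ M) (hψ : ∀ x ∈ Icc a b, |ψ x| ≤ M) :
    |∫ x in a..b, (deriv f x * ψ x - deriv g x * φ x)| ≤ M * pathLength f g a b := by
  have := hf.continuous_deriv_one
  have := hg.continuous_deriv_one
  rw [pathLength, ← intervalIntegral.integral_const_mul, ← Real.norm_eq_abs]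
  refine intervalIntegral.norm_integral_le_of_norm_le hab (.of_forall fun x hx => ?_)
    (Continuous.intervalIntegrable (by fun_prop) _ _)
  have hx : x ∈ Icc a b := Ioc_subset_Icc_self hx
  calc |deriv f x * ψ x - deriv g x * φ x|
      ≤ |deriv f x| * |ψ x| + |deriv g x| * |φ x| := by
        rw [← abs_mul, ← abs_mul]; exact abs_sub _ _
    _ ≤ |deriv f x| * M + |deriv g x| * M := by
        gcongr
        exacts [hψ x hx, hφ x hx]
    _ = M * (|deriv f x| + |deriv g x|) := by ring

lemma abs_sweptArea_le (hab : a ≤ b) (hf : ∀ x ∈ Icc a b, |f x| ≤ M)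
    (hg : ∀ x ∈ Icc a b, |g x| ≤ M) (hf' : ∀ x ∈ Icc a b, |deriv f x| ≤ N)
    (hg' : ∀ x ∈ Icc a b, |deriv g x| ≤ N) : |sweptArea f g a b| ≤ 2 * M * N * (b - a) := by
  have h := intervalIntegral.norm_integral_le_of_norm_le_const (a := a) (b := b)
    (C := 2 * M * N) (f := fun x => deriv f x * g x - deriv g x * f x) fun x hx => ?_
  · rwa [Real.norm_eq_abs, abs_of_nonneg (sub_nonneg.2 hab)] at h
  have hx : x ∈ Icc a b := Ioc_subset_Icc_self (by rwa [uIoc_of_le hab] at hx)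
  have hN : 0 ≤ N := (abs_nonneg _).trans (hf' x hx)
  calc |deriv f x * g x - deriv g x * f x| ≤ |deriv f x| * |g x| + |deriv g x| * |f x| := by
        rw [← abs_mul, ← abs_mul]; exact abs_sub _ _
    _ ≤ N * M + N * M := by
        gcongr
        exacts [hf' x hx, hg x hx, hg' x hx, hf x hx]
    _ = 2 * M * N := by ring

lemma abs_sweptArea_add_sub_le (hf : ContDiff ℝ 1 f) (hg : ContDiff ℝ 1 g) (hφ : ContDiff ℝ 1 φ)
    (hψ : ContDiff ℝ 1 ψ) (hab : a ≤ b) (hφa : φ a = 0) (hψa : ψ a = 0)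
    (hφM : ∀ x ∈ Icc a b, |φ x| ≤ M) (hψM : ∀ x ∈ Icc a b, |ψ x| ≤ M)
    (hφN : ∀ x ∈ Icc a b, |deriv φ x| ≤ N) (hψN : ∀ x ∈ Icc a b, |deriv ψ x| ≤ N) :
    |sweptArea (f + φ) (g + ψ) a b - (sweptArea f g a b + φ b * g a - ψ b * f a)|
      ≤ 3 * M * pathLength f g a b + 2 * M * N * (b - a) := by
  have hb : b ∈ Icc a b := right_mem_Icc.2 hab
  have hM : 0 ≤ M := (abs_nonneg _).trans (hφM b hb)
  have endpoint : |φ b * (g b - g a) - ψ b * (f b - f a)| ≤ M * pathLength f g a b :=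
    calc |φ b * (g b - g a) - ψ b * (f b - f a)|
        ≤ |φ b| * |g b - g a| + |ψ b| * |f b - f a| := by
          rw [← abs_mul, ← abs_mul]; exact abs_sub _ _
      _ ≤ M * |g b - g a| + M * |f b - f a| := by
          gcongr
          exacts [hφM b hb, hψM b hb]
      _ = M * (|f b - f a| + |g b - g a|) := by ring
      _ ≤ M * pathLength f g a b := by
          gcongr
          exact abs_sub_add_abs_sub_le_pathLength hf hg hab
  have mixed := abs_integral_le_mul_pathLength hf hg hab hφM hψM
  have small := abs_sweptArea_le hab hφM hψM hφN hψN
  rw [sweptArea_add hf hg hφ hψ, hφa, hψa]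
  rw [abs_le] at *
  constructor <;> linarith

end SweptArea

/-! ### Taylor polynomials and Whitney fields -/

section Taylor

variable {m k : ℕ} {F G : ℕ → ℝ → ℝ} {a x : ℝ}

lemma eval_iterate_derivative_taylorPoly (hk : k ≤ m) (F : ℕ → ℝ → ℝ) (a x : ℝ) :
    (derivative^[k] (taylorPoly m F a)).eval x
      = ∑ l ∈ Finset.range (m - k + 1), F (k + l) a / (l.factorial : ℝ) * (x - a) ^ l := by
  rw [taylorPoly, iterate_derivative_sum, eval_finsetSum, show m + 1 = k + (m - k + 1) by omega,
    Finset.sum_range_add, Finset.sum_eq_zero, zero_add]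
  · refine Finset.sum_congr rfl fun l _ => ?_
    have h := Nat.factorial_mul_descFactorial (Nat.le_add_right k l)
    rw [Nat.add_sub_cancel_left] at h
    have hne : ((k + l).factorial : ℝ) ≠ 0 := by positivity
    simp only [iterate_derivative_C_mul, iterate_derivative_X_sub_pow, eval_mul, eval_C,
      nsmul_eq_mul, eval_natCast, eval_pow, eval_sub, eval_X, Nat.add_sub_cancel_left]
    rw [← h, Nat.cast_mul] at hne ⊢
    have := left_ne_zero_of_mul hne
    have := right_ne_zero_of_mul hne
    field_simp
  · intro l hl
    rw [iterate_derivative_C_mul, iterate_derivative_X_sub_pow,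
      Nat.descFactorial_of_lt (Finset.mem_range.1 hl)]
    simp

lemma remainder_eq (hk : k ≤ m) (F : ℕ → ℝ → ℝ) (a x : ℝ) :
    remainder m F a k x = F k x - (derivative^[k] (taylorPoly m F a)).eval x := by
  rw [remainder, eval_iterate_derivative_taylorPoly hk]

lemma eval_iterate_derivative_taylorPoly_self (hk : k ≤ m) (F : ℕ → ℝ → ℝ) (a : ℝ) :
    (derivative^[k] (taylorPoly m F a)).eval a = F k a := by
  rw [eval_iterate_derivative_taylorPoly hk, Finset.sum_range_succ']
  simp

lemma remainder_self (hk : k ≤ m) (F : ℕ → ℝ → ℝ) (a : ℝ) : remainder m F a k a = 0 := by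
  rw [remainder_eq hk, eval_iterate_derivative_taylorPoly_self hk, sub_self]

lemma remainder_top (m : ℕ) (F : ℕ → ℝ → ℝ) (a x : ℝ) :
    remainder m F a m x = F m x - F m a := by
  simp [remainder]

lemma remainder_congr (hk : k ≤ m) (ha : ∀ j ≤ m, F j a = G j a) (hx : F k x = G k x) :
    remainder m F a k x = remainder m G a k x := by
  rw [remainder, remainder, hx]
  congr 1
  refine Finset.sum_congr rfl fun l hl => ?_
  rw [ha (k + l) (by have := Finset.mem_range.1 hl; omega)]

lemma taylorPoly_congr (ha : ∀ j ≤ m, F j a = G j a) : taylorPoly m F a = taylorPoly m G a :=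
  Finset.sum_congr rfl fun l hl => by rw [ha l (Nat.lt_succ_iff.1 (Finset.mem_range.1 hl))]

lemma contDiff_eval (p : ℝ[X]) {n : WithTop ℕ∞} : ContDiff ℝ n fun x => p.eval x := by
  simpa using p.contDiff_aeval (𝕜 := ℝ) n

lemma hasDerivAt_iterate_derivative (p : ℝ[X]) (k : ℕ) (x : ℝ) :
    HasDerivAt (fun x => (derivative^[k] p).eval x) ((derivative^[k + 1] p).eval x) x := by
  rw [Function.iterate_succ_apply']
  exact (derivative^[k] p).hasDerivAt x

lemma areaDiscrepancy_eq (m : ℕ) (F G H : ℕ → ℝ → ℝ) (a b : ℝ) :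
    areaDiscrepancy m F G H a b = H 0 b - H 0 a
      - 2 * (sweptArea (taylorPoly m F a).eval (taylorPoly m G a).eval a b
        + remainder m F a 0 b * G 0 a - remainder m G a 0 b * F 0 a) := by
  simp only [areaDiscrepancy, sweptArea, Polynomial.deriv, remainder_eq (Nat.zero_le m),
    Function.iterate_zero_apply]
  ring

lemma velocity_eq (m : ℕ) (F G : ℕ → ℝ → ℝ) (a b : ℝ) :
    velocity m F G a b = (b - a) ^ (2 * m)
      + (b - a) ^ m * pathLength (taylorPoly m F a).eval (taylorPoly m G a).eval a b := by
  simp only [velocity, pathLength, Polynomial.deriv]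

end Taylor

section Extension

variable {m k : ℕ} {K : Set ℝ} {F : ℕ → ℝ → ℝ} {f : ℝ → ℝ} {a b x ε : ℝ}

/-- The jet of all derivatives of `f`. -/
noncomputable def derivJet (f : ℝ → ℝ) : ℕ → ℝ → ℝ := fun k => iteratedDeriv k f

/-- The function `f` extends the jet `F` of order `m` on `K`. -/
structure IsExtension (m : ℕ) (K : Set ℝ) (F : ℕ → ℝ → ℝ) (f : ℝ → ℝ) : Prop where
  contDiff : ContDiff ℝ m f
  eqOn : ∀ k ≤ m, EqOn (derivJet f k) (F k) K

lemma hasDerivAt_derivJet (hf : ContDiff ℝ m f) (hk : k < m) (x : ℝ) :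
    HasDerivAt (derivJet f k) (derivJet f (k + 1) x) x := by
  simp only [derivJet, iteratedDeriv_succ]
  exact (hf.differentiable_iteratedDeriv k (mod_cast hk) x).hasDerivAt

lemma hasDerivAt_remainder (hf : ContDiff ℝ m f) (hk : k < m) (a x : ℝ) :
    HasDerivAt (remainder m (derivJet f) a k) (remainder m (derivJet f) a (k + 1) x) x := by
  rw [remainder_eq hk, funext (remainder_eq hk.le (derivJet f) a)]
  exact (hasDerivAt_derivJet hf hk x).sub
    (hasDerivAt_iterate_derivative (taylorPoly m (derivJet f) a) k x)

lemma contDiff_remainder (hf : ContDiff ℝ m f) (a : ℝ) :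
    ContDiff ℝ m (remainder m (derivJet f) a 0) := by
  rw [funext (remainder_eq (Nat.zero_le m) (derivJet f) a)]
  exact (by simpa [derivJet] using hf : ContDiff ℝ m (derivJet f 0)).sub (contDiff_eval _)

lemma eval_taylorPoly_add_remainder (m : ℕ) (f : ℝ → ℝ) (a : ℝ) :
    (taylorPoly m (derivJet f) a).eval + remainder m (derivJet f) a 0 = f := by
  ext x
  simp [remainder_eq, derivJet]

lemma abs_remainder_le (hf : ContDiff ℝ m f)
    (osc : ∀ y ∈ uIcc a b, |derivJet f m y - derivJet f m a| ≤ ε) (hk : k ≤ m)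
    (hx : x ∈ uIcc a b) : |remainder m (derivJet f) a k x| ≤ ε * |x - a| ^ (m - k) := by
  induction hk using Nat.decreasingInduction generalizing x with
  | self => simpa [remainder_top] using osc x hx
  | of_succ k hk ih =>
    have hε : 0 ≤ ε := (abs_nonneg _).trans (osc x hx)
    have mvt := (convex_uIcc a x).norm_image_sub_le_of_norm_hasDerivWithin_le
      (C := ε * |x - a| ^ (m - (k + 1)))
      (fun y _ => (hasDerivAt_remainder hf hk a y).hasDerivWithinAt)
      (fun y hy => (ih (uIcc_subset_uIcc left_mem_uIcc hx hy)).trans <| by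
        gcongr ?_ * ?_ ^ _
        exact abs_sub_left_of_mem_uIcc hy)
      left_mem_uIcc right_mem_uIcc
    rwa [remainder_self hk.le, sub_zero, Real.norm_eq_abs, Real.norm_eq_abs, mul_assoc, ← pow_succ,
      show m - (k + 1) + 1 = m - k by omega] at mvt

lemma exists_abs_remainder_le (hf : ContDiff ℝ m f) (hK : Bornology.IsBounded K) (hε : 0 < ε) :
    ∃ δ : ℝ, 0 < δ ∧ ∀ a ∈ K, ∀ b ∈ K, |a - b| < δ → ∀ k ≤ m, ∀ x ∈ uIcc a b,
      |remainder m (derivJet f) a k x| ≤ ε * |b - a| ^ (m - k) := by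
  set I : Set ℝ := Icc (sInf K) (sSup K)
  have hKI : K ⊆ I := hK.subset_Icc_sInf_sSup
  have uniform : UniformContinuousOn (derivJet f m) I :=
    isCompact_Icc.uniformContinuousOn_of_continuous
      (hf.continuous_iteratedDeriv m le_rfl).continuousOn
  obtain ⟨δ, hδ, H⟩ := Metric.uniformContinuousOn_iff_le.1 uniform ε hε
  refine ⟨δ, hδ, fun a ha b hb hab k hk x hx =>
    (abs_remainder_le (ε := ε) hf (b := b) (fun y hy => ?_) hk hx).trans ?_⟩
  · refine H y (ordConnected_Icc.uIcc_subset (hKI ha) (hKI hb) hy) a (hKI ha) ?_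
    rw [abs_sub_comm] at hab
    exact (abs_sub_left_of_mem_uIcc hy).trans hab.le
  · gcongr ?_ * ?_ ^ _
    exact abs_sub_left_of_mem_uIcc hx

lemma IsExtension.taylorPoly_eq (hf : IsExtension m K F f) (ha : a ∈ K) :
    taylorPoly m (derivJet f) a = taylorPoly m F a :=
  taylorPoly_congr fun j hj => hf.eqOn j hj ha

lemma IsExtension.remainder_eq (hf : IsExtension m K F f) (hk : k ≤ m) (ha : a ∈ K) (hx : x ∈ K) :
    remainder m (derivJet f) a k x = remainder m F a k x :=
  remainder_congr hk (fun j hj => hf.eqOn j hj ha) (hf.eqOn k hk hx)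

lemma IsExtension.isWhitneyField (hf : IsExtension m K F f) (hK : Bornology.IsBounded K) :
    IsWhitneyField m K F := by
  intro k hk ε hε
  obtain ⟨δ, hδ, H⟩ := exists_abs_remainder_le hf.contDiff hK hε
  refine ⟨δ, hδ, fun a ha b hb hab => ?_⟩
  rw [← hf.remainder_eq hk ha hb, abs_sub_comm a b]
  exact H a ha b hb hab k hk b right_mem_uIcc

end Extension

section WhitneyField

variable {m k : ℕ} {K : Set ℝ} {F : ℕ → ℝ → ℝ} {x ε : ℝ}

lemma IsWhitneyField.hasDerivWithinAt (hF : IsWhitneyField m K F) (hk : k < m) (hx : x ∈ K) :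
    HasDerivWithinAt (F k) (F (k + 1) x) K x := by
  have flat : HasDerivWithinAt (remainder m F x k) 0 K x := by
    rw [hasDerivWithinAt_iff_isLittleO, isLittleO_iff]
    intro ε hε
    obtain ⟨δ, hδ, H⟩ := hF k hk.le ε hε
    filter_upwards [nhdsWithin_le_nhds (Metric.ball_mem_nhds x (lt_min hδ one_pos)),
      self_mem_nhdsWithin] with y hy hyK
    rw [Metric.mem_ball, dist_comm, Real.dist_eq, lt_min_iff] at hy
    rw [remainder_self hk.le, sub_zero, smul_zero, sub_zero, Real.norm_eq_abs, Real.norm_eq_abs,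
      abs_sub_comm y x]
    refine (H x hx y hyK hy.1).trans ?_
    gcongr
    exact pow_le_of_le_one (abs_nonneg _) hy.2.le (by omega)
  have taylor := hasDerivAt_iterate_derivative (taylorPoly m F x) k x
  rw [eval_iterate_derivative_taylorPoly_self hk] at taylor
  simpa [funext (remainder_eq hk.le F x), Pi.add_def] using flat.add taylor.hasDerivWithinAt

lemma IsWhitneyField.continuousOn_top (hF : IsWhitneyField m K F) : ContinuousOn (F m) K := by
  rw [Metric.continuousOn_iff]
  intro x hx ε hε
  obtain ⟨δ, hδ, H⟩ := hF m le_rfl (ε / 2) (half_pos hε)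
  refine ⟨δ, hδ, fun y hy hyx => ?_⟩
  have h := H x hx y hy (by rwa [dist_comm, Real.dist_eq] at hyx)
  rw [remainder_top, Nat.sub_self, pow_zero, mul_one] at h
  exact h.trans_lt (half_lt_self hε)

lemma IsWhitneyField.eventually_abs_remainder_le (hF : IsWhitneyField m K F) (hε : 0 < ε) :
    ∀ᶠ p in shortIntervals K, ∀ k ≤ m, |remainder m F p.1 k p.2| ≤ ε * (p.2 - p.1) ^ (m - k) := by
  simp only [← Finset.mem_range_succ_iff, ← Finset.mem_coe]
  refine (eventually_all_finite (Finset.finite_toSet _)).2 fun k hk => ?_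
  refine (eventually_shortIntervals
    (P := fun a b => |remainder m F a k b| ≤ ε * (b - a) ^ (m - k))).2 ?_
  obtain ⟨δ, hδ, H⟩ := hF k (Finset.mem_range_succ_iff.1 hk) ε hε
  refine ⟨δ, hδ, fun a ha b hb hab hlt => ?_⟩
  rw [← abs_of_pos (sub_pos.2 hab)] at hlt ⊢
  exact abs_sub_comm b a ▸ H a ha b hb (abs_sub_comm b a ▸ hlt)

end WhitneyField

/-! ### Horizontal curves as lifts of plane curves -/

/-- The curve `(f, g, h)` satisfies the contact equation: `h` lifts the plane curve `(f, g)`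
horizontally. -/
def IsHorizontalLift (f g h : ℝ → ℝ) : Prop :=
  ∀ t, HasDerivAt h (2 * (deriv f t * g t - deriv g t * f t)) t

section HorizontalLift

variable {m k : ℕ} {K : Set ℝ} {F G H : ℕ → ℝ → ℝ} {f g h : ℝ → ℝ} {a b ε : ℝ}

lemma isHorizontalAt_iff (x y t u v w : ℝ) :
    IsHorizontalAt (x, y, t) (u, v, w) ↔ w = 2 * (u * y - v * x) := by
  simp only [IsHorizontalAt, fieldX, fieldY, Submodule.mem_span_pair, Prod.smul_mk, Prod.mk_add_mk,
    Prod.mk.injEq, smul_eq_mul]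
  constructor
  · rintro ⟨a, b, rfl, rfl, rfl⟩
    ring
  · rintro rfl
    exact ⟨u, v, by ring, by ring, by ring⟩

lemma contDiff_curve_iff {n : WithTop ℕ∞} :
    ContDiff ℝ n (fun t => ((f t, g t, h t) : Heis)) ↔
      ContDiff ℝ n f ∧ ContDiff ℝ n g ∧ ContDiff ℝ n h :=
  ⟨fun H => ⟨H.fst, H.snd.fst, H.snd.snd⟩, fun H => H.1.prodMk (H.2.1.prodMk H.2.2)⟩

lemma isHorizontalCurve_iff (hf : ContDiff ℝ 1 f) (hg : ContDiff ℝ 1 g) (hh : ContDiff ℝ 1 h) :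
    IsHorizontalCurve (fun t => ((f t, g t, h t) : Heis)) ↔ IsHorizontalLift f g h := by
  have pointwise (t : ℝ) : IsHorizontalAt ((f t, g t, h t) : Heis)
      (deriv (fun t => ((f t, g t, h t) : Heis)) t) ↔
        deriv h t = 2 * (deriv f t * g t - deriv g t * f t) := by
    rw [((hf.differentiable_one t).hasDerivAt.prodMk
      ((hg.differentiable_one t).hasDerivAt.prodMk (hh.differentiable_one t).hasDerivAt)).deriv,
      isHorizontalAt_iff]
  simp only [IsHorizontalCurve, pointwise]
  constructor
  · rintro ⟨-, contact⟩ t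
    have := (Continuous.ae_eq_iff_eq MeasureTheory.volume hh.continuous_deriv_one
      ((continuous_areaForm hf hg).const_mul 2)).1 contact
    exact (hh.differentiable_one t).hasDerivAt.congr_deriv (congrFun this t)
  · intro lift
    refine ⟨fun a b => ?_, .of_forall fun t => (lift t).deriv⟩
    obtain ⟨C, hC⟩ := (contDiff_curve_iff.2 ⟨hf, hg, hh⟩).contDiffOn.exists_lipschitzOnWith
      one_ne_zero (convex_uIcc a b) isCompact_uIcc
    exact hC.absolutelyContinuousOnInterval

lemma extendsTo_iff (hm : 1 ≤ m) :
    ExtendsTo m K F G H f g h ↔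
      IsExtension m K F f ∧ IsExtension m K G g ∧ IsExtension m K H h ∧
        IsHorizontalLift f g h := by
  rw [ExtendsTo, contDiff_curve_iff]
  have hm : (1 : WithTop ℕ∞) ≤ m := mod_cast hm
  constructor
  · rintro ⟨⟨cf, cg, ch⟩, hor, ext⟩
    exact ⟨⟨cf, fun k hk x hx => (ext k hk x hx).1⟩, ⟨cg, fun k hk x hx => (ext k hk x hx).2.1⟩,
      ⟨ch, fun k hk x hx => (ext k hk x hx).2.2⟩,
      (isHorizontalCurve_iff (cf.of_le hm) (cg.of_le hm) (ch.of_le hm)).1 hor⟩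
  · rintro ⟨hf, hg, hh, lift⟩
    exact ⟨⟨hf.contDiff, hg.contDiff, hh.contDiff⟩,
      (isHorizontalCurve_iff (hf.contDiff.of_le hm) (hg.contDiff.of_le hm)
        (hh.contDiff.of_le hm)).2 lift,
      fun k hk x hx => ⟨hf.eqOn k hk hx, hg.eqOn k hk hx, hh.eqOn k hk hx⟩⟩

lemma IsHorizontalLift.contDiff (lift : IsHorizontalLift f g h) (hm : 1 ≤ m)
    (hf : ContDiff ℝ m f) (hg : ContDiff ℝ m g) : ContDiff ℝ m h := by
  obtain ⟨n, rfl⟩ := Nat.exists_eq_add_of_le' hm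
  rw [Nat.cast_succ] at *
  rw [contDiff_succ_iff_deriv, funext fun t => (lift t).deriv]
  have hn : (n : WithTop ℕ∞) ≤ n + 1 := mod_cast n.le_succ
  exact ⟨fun t => (lift t).differentiableAt, by simp, contDiff_const.mul
    (((contDiff_succ_iff_deriv.1 hf).2.2.mul (hg.of_le hn)).sub
      ((contDiff_succ_iff_deriv.1 hg).2.2.mul (hf.of_le hn)))⟩

lemma IsHorizontalLift.sub_eq (lift : IsHorizontalLift f g h) (hf : ContDiff ℝ 1 f)
    (hg : ContDiff ℝ 1 g) (a b : ℝ) : h b - h a = 2 * sweptArea f g a b := by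
  rw [sweptArea, ← intervalIntegral.integral_const_mul,
    intervalIntegral.integral_eq_sub_of_hasDerivAt (fun t _ => lift t)]
  exact (continuous_const.mul (continuous_areaForm hf hg)).intervalIntegrable _ _

lemma eval_horizPoly (k : ℕ) (u v : ℕ → ℝ) :
    MvPolynomial.eval (Sum.elim u v) (horizPoly k) = 2 * ∑ i ∈ Finset.range k,
      ((k - 1).choose i : ℝ) * (u (i + 1) * v (k - 1 - i) - v (i + 1) * u (k - 1 - i)) := by
  simp [horizPoly]

lemma eval_horizPoly_congr {u v u' v' : ℕ → ℝ} (hk : k ≤ m) (hu : ∀ j ≤ m, u j = u' j)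
    (hv : ∀ j ≤ m, v j = v' j) :
    MvPolynomial.eval (Sum.elim u v) (horizPoly k)
      = MvPolynomial.eval (Sum.elim u' v') (horizPoly k) := by
  rw [eval_horizPoly, eval_horizPoly]
  congr 1
  refine Finset.sum_congr rfl fun i hi => ?_
  rw [Finset.mem_range] at hi
  rw [hu (i + 1) (by omega), hu (k - 1 - i) (by omega), hv (i + 1) (by omega),
    hv (k - 1 - i) (by omega)]

lemma IsHorizontalLift.derivJet_eq (lift : IsHorizontalLift f g h) (hf : ContDiff ℝ k f)
    (hg : ContDiff ℝ k g) (hk : 1 ≤ k) (t : ℝ) :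
    derivJet h k t = MvPolynomial.eval
      (Sum.elim (fun j => derivJet f j t) (fun j => derivJet g j t)) (horizPoly k) := by
  obtain ⟨n, rfl⟩ := Nat.exists_eq_add_of_le' hk
  rw [Nat.cast_succ] at *
  have hn : (n : WithTop ℕ∞) ≤ n + 1 := mod_cast n.le_succ
  have cf := (hf.of_le hn).contDiffAt (x := t)
  have cg := (hg.of_le hn).contDiffAt (x := t)
  have cf' := (contDiff_succ_iff_deriv.1 hf).2.2.contDiffAt (x := t)
  have cg' := (contDiff_succ_iff_deriv.1 hg).2.2.contDiffAt (x := t)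
  have hh : deriv h = fun t => 2 * (deriv f * g - deriv g * f) t := funext fun t => (lift t).deriv
  rw [derivJet, iteratedDeriv_succ', hh, iteratedDeriv_const_mul_field,
    iteratedDeriv_sub (f := deriv f * g) (g := deriv g * f) (cf'.mul cg) (cg'.mul cf),
    iteratedDeriv_mul cf' cg, iteratedDeriv_mul cg' cf, eval_horizPoly, ← Finset.sum_sub_distrib]
  congr 1
  refine Finset.sum_congr rfl fun i _ => ?_
  simp only [derivJet, Nat.add_sub_cancel, iteratedDeriv_succ']
  ring

lemma IsHorizontalLift.eqOn_horizPoly (lift : IsHorizontalLift f g h) (hf : IsExtension m K F f)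
    (hg : IsExtension m K G g) (hk : 1 ≤ k) (hkm : k ≤ m) :
    EqOn (derivJet h k) (fun t => MvPolynomial.eval
      (Sum.elim (fun j => F j t) (fun j => G j t)) (horizPoly k)) K := by
  intro t ht
  have hle : (k : WithTop ℕ∞) ≤ m := mod_cast hkm
  rw [lift.derivJet_eq (hf.contDiff.of_le hle) (hg.contDiff.of_le hle) hk]
  exact eval_horizPoly_congr hkm (fun j hj => hf.eqOn j hj ht) fun j hj => hg.eqOn j hj ht

/-! ### The area discrepancy of a horizontal curve -/

lemma velocity_pos (m : ℕ) (F G : ℕ → ℝ → ℝ) (hab : a < b) : 0 < velocity m F G a b := by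
  have := sub_pos.2 hab
  have := pathLength_nonneg (taylorPoly m F a).eval (taylorPoly m G a).eval hab.le
  rw [velocity_eq]
  positivity

lemma areaDiscrepancy_isLittleO_iff :
    (fun p => areaDiscrepancy m F G H p.1 p.2) =o[shortIntervals K]
        (fun p => velocity m F G p.1 p.2) ↔
      ∀ ε : ℝ, 0 < ε → ∃ δ : ℝ, 0 < δ ∧ ∀ a ∈ K, ∀ b ∈ K, a < b → b - a < δ →
        |areaDiscrepancy m F G H a b / velocity m F G a b| < ε := by
  rw [isLittleO_iff_tendsto', Metric.tendsto_nhds]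
  · simp only [Real.dist_0_eq_abs]
    exact forall₂_congr fun ε _ => eventually_shortIntervals
      (P := fun a b => |areaDiscrepancy m F G H a b / velocity m F G a b| < ε)
  · filter_upwards [eventually_mem_shortIntervals K] with p hp hV
    exact absurd hV (velocity_pos m F G hp.2.2).ne'

lemma IsHorizontalLift.areaDiscrepancy_derivJet (lift : IsHorizontalLift f g h)
    (hf : ContDiff ℝ 1 f) (hg : ContDiff ℝ 1 g) (m : ℕ) (a b : ℝ) :
    areaDiscrepancy m (derivJet f) (derivJet g) (derivJet h) a b = 2 * (sweptArea f g a b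
      - (sweptArea (taylorPoly m (derivJet f) a).eval (taylorPoly m (derivJet g) a).eval a b
        + remainder m (derivJet f) a 0 b * g a - remainder m (derivJet g) a 0 b * f a)) := by
  have := lift.sub_eq hf hg a b
  rw [areaDiscrepancy_eq]
  simp only [derivJet, iteratedDeriv_zero] at *
  linarith

lemma IsHorizontalLift.abs_areaDiscrepancy_le (lift : IsHorizontalLift f g h) (hm : 1 ≤ m)
    (hf : ContDiff ℝ m f) (hg : ContDiff ℝ m g) (hab : a ≤ b) (hε : ε ∈ Icc 0 1)
    (hrf : ∀ k ≤ 1, ∀ x ∈ Icc a b, |remainder m (derivJet f) a k x| ≤ ε * (b - a) ^ (m - k))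
    (hrg : ∀ k ≤ 1, ∀ x ∈ Icc a b, |remainder m (derivJet g) a k x| ≤ ε * (b - a) ^ (m - k)) :
    |areaDiscrepancy m (derivJet f) (derivJet g) (derivJet h) a b|
      ≤ 6 * ε * velocity m (derivJet f) (derivJet g) a b := by
  have hm' : (1 : WithTop ℕ∞) ≤ m := mod_cast hm
  have deriv_remainder {u : ℝ → ℝ} (hu : ContDiff ℝ m u) :
      deriv (remainder m (derivJet u) a 0) = remainder m (derivJet u) a 1 :=
    funext fun x => (hasDerivAt_remainder hu hm a x).deriv
  have area := abs_sweptArea_add_sub_le (contDiff_eval (taylorPoly m (derivJet f) a))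
    (contDiff_eval (taylorPoly m (derivJet g) a)) ((contDiff_remainder hf a).of_le hm')
    ((contDiff_remainder hg a).of_le hm') hab (remainder_self (Nat.zero_le m) _ a)
    (remainder_self (Nat.zero_le m) _ a) (hrf 0 zero_le_one) (hrg 0 zero_le_one)
    (by simpa only [deriv_remainder hf] using hrf 1 le_rfl)
    (by simpa only [deriv_remainder hg] using hrg 1 le_rfl)
  have value (u : ℝ → ℝ) : (taylorPoly m (derivJet u) a).eval a = u a := by
    simpa [derivJet] using eval_iterate_derivative_taylorPoly_self (Nat.zero_le m) (derivJet u) a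
  simp only [eval_taylorPoly_add_remainder, value, Nat.sub_zero] at area
  rw [lift.areaDiscrepancy_derivJet (hf.of_le hm') (hg.of_le hm'), abs_mul, abs_two, velocity_eq]
  set L := pathLength (taylorPoly m (derivJet f) a).eval (taylorPoly m (derivJet g) a).eval a b
  calc 2 * |_| ≤ 2 * (3 * (ε * (b - a) ^ m) * L
        + 2 * (ε * (b - a) ^ m) * (ε * (b - a) ^ (m - 1)) * (b - a)) := by gcongr
    _ = 6 * ε * ((b - a) ^ m * L) + 4 * ε * ε * (b - a) ^ (2 * m) := by
      rw [show 2 * m = m + (m - 1) + 1 by omega]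
      ring
    _ ≤ 6 * ε * ((b - a) ^ m * L) + 6 * ε * 1 * (b - a) ^ (2 * m) := by
      have := sub_nonneg.2 hab
      have := hε.1
      gcongr
      · norm_num
      · exact hε.2
    _ = 6 * ε * ((b - a) ^ (2 * m) + (b - a) ^ m * L) := by ring

lemma IsExtension.velocity_eq (hf : IsExtension m K F f) (hg : IsExtension m K G g)
    (ha : a ∈ K) : velocity m (derivJet f) (derivJet g) a b = velocity m F G a b := by
  simp only [velocity, hf.taylorPoly_eq ha, hg.taylorPoly_eq ha]

lemma IsExtension.areaDiscrepancy_eq (hf : IsExtension m K F f) (hg : IsExtension m K G g)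
    (hh : EqOn h (H 0) K) (ha : a ∈ K) (hb : b ∈ K) :
    areaDiscrepancy m (derivJet f) (derivJet g) (derivJet h) a b = areaDiscrepancy m F G H a b := by
  have valF {x : ℝ} (hx : x ∈ K) := hf.eqOn 0 (Nat.zero_le m) hx
  have valG {x : ℝ} (hx : x ∈ K) := hg.eqOn 0 (Nat.zero_le m) hx
  have valH {x : ℝ} (hx : x ∈ K) : derivJet h 0 x = H 0 x := by simpa [derivJet] using hh hx
  simp only [areaDiscrepancy, hf.taylorPoly_eq ha, hg.taylorPoly_eq ha, valF ha, valF hb, valG ha,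
    valG hb, valH ha, valH hb]

lemma IsHorizontalLift.areaDiscrepancy_isLittleO (lift : IsHorizontalLift f g h) (hm : 1 ≤ m)
    (hK : Bornology.IsBounded K) (hf : IsExtension m K F f) (hg : IsExtension m K G g)
    (hh : EqOn h (H 0) K) :
    (fun p => areaDiscrepancy m F G H p.1 p.2) =o[shortIntervals K]
        (fun p => velocity m F G p.1 p.2) := by
  refine isLittleO_iff.2 fun c hc => ?_
  obtain ⟨ε, hεc, hε1, hε⟩ : ∃ ε : ℝ, 6 * ε ≤ c ∧ ε ≤ 1 ∧ 0 < ε :=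
    ((eventually_const_mul_le hc 6).and ((eventually_le_nhds one_pos).filter_mono
      nhdsWithin_le_nhds |>.and self_mem_nhdsWithin)).exists
  refine (eventually_shortIntervals (P := fun a b => ‖areaDiscrepancy m F G H a b‖
    ≤ c * ‖velocity m F G a b‖)).2 ?_
  obtain ⟨δ, hδ, rf⟩ := exists_abs_remainder_le hf.contDiff hK hε
  obtain ⟨δ', hδ', rg⟩ := exists_abs_remainder_le hg.contDiff hK hε
  refine ⟨min δ δ', lt_min hδ hδ', fun a ha b hb hab hlt => ?_⟩
  have h0 : 0 < b - a := sub_pos.2 hab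
  rw [← abs_of_pos h0, abs_sub_comm, lt_min_iff] at hlt
  have main := lift.abs_areaDiscrepancy_le hm hf.contDiff hg.contDiff hab.le ⟨hε.le, hε1⟩
    (fun k hk x hx => abs_of_pos h0 ▸ rf a ha b hb hlt.1 k (hk.trans hm) x (Icc_subset_uIcc hx))
    (fun k hk x hx => abs_of_pos h0 ▸ rg a ha b hb hlt.2 k (hk.trans hm) x (Icc_subset_uIcc hx))
  rw [hf.velocity_eq hg ha, hf.areaDiscrepancy_eq hg hh ha hb] at main
  have hV := velocity_pos m F G hab
  rw [Real.norm_eq_abs, Real.norm_eq_abs, abs_of_pos hV]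
  exact main.trans (by gcongr)

end HorizontalLift

/-! ### Corrections of the swept area -/

section BumpInner

lemma exists_norm_le_mul_sqrt_inner {V W : Type*} [AddCommGroup V] [Module ℝ V]
    [FiniteDimensional ℝ V] [NormedAddCommGroup W] [NormedSpace ℝ W]
    (core : InnerProductSpace.Core ℝ V) (T : V →ₗ[ℝ] W) :
    ∃ C : ℝ, ∀ v, ‖T v‖ ≤ C * √(core.inner v v) := by
  let := core.toNormedAddCommGroup
  let := InnerProductSpace.ofCore core.toCore
  refine ⟨‖T.toContinuousLinearMap‖, fun v => ?_⟩
  have norm_eq : ‖v‖ = √(core.inner v v) := norm_eq_sqrt_real_inner v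
  exact norm_eq ▸ T.toContinuousLinearMap.le_opNorm v

/-- The weight `x ^ (m + 1) * (1 - x) ^ (m + 1)`; a multiple of it vanishes at `0` and at `1`
together with its derivatives up to order `m`. -/
noncomputable def bump (m : ℕ) : ℝ[X] := X ^ (m + 1) * (1 - X) ^ (m + 1)

lemma bump_pos (m : ℕ) {x : ℝ} (hx : x ∈ Ioo 0 1) : 0 < (bump m).eval x := by
  have := hx.1
  have := sub_pos.2 hx.2
  simp only [bump, eval_mul, eval_pow, eval_X, eval_sub, eval_one]
  positivity

/-- The inner product `∫₀¹ p q w` of polynomials with the weight `w = bump m`. -/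
noncomputable def bumpInner (m : ℕ) (p q : ℝ[X]) : ℝ :=
  ∫ x in (0 : ℝ)..1, (bump m * p * q).eval x

lemma intervalIntegrable_eval (p : ℝ[X]) (a b : ℝ) :
    IntervalIntegrable p.eval MeasureTheory.volume a b :=
  p.continuous.intervalIntegrable a b

lemma bumpInner_self_pos (m : ℕ) {p : ℝ[X]} (hp : p ≠ 0) : 0 < bumpInner m p p := by
  have nonneg (x : ℝ) (hx : x ∈ Icc 0 1) : 0 ≤ (bump m * p * p).eval x := by
    have := hx.1
    have := sub_nonneg.2 hx.2
    simp only [bump, mul_assoc, eval_mul, eval_pow, eval_X, eval_sub, eval_one]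
    have := mul_self_nonneg (p.eval x)
    positivity
  obtain ⟨c, hc, hpc⟩ : ∃ c ∈ Ioo (0 : ℝ) 1, p.eval c ≠ 0 := by
    by_contra! h
    exact hp (eq_zero_of_infinite_isRoot p ((Ioo_infinite zero_lt_one).mono h))
  refine intervalIntegral.integral_pos zero_lt_one (Polynomial.continuousOn _)
    (fun x hx => nonneg x (Ioc_subset_Icc_self hx)) ⟨c, Ioo_subset_Icc_self hc, ?_⟩
  simpa only [eval_mul, mul_assoc] using mul_pos (bump_pos m hc) (mul_self_pos.2 hpc)

/-- `bumpInner m` as an inner product on the space of polynomials of degree at most `m`. -/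
@[reducible]
noncomputable def bumpCore (m : ℕ) : InnerProductSpace.Core ℝ (degreeLT ℝ (m + 1)) where
  inner p q := bumpInner m p q
  conj_inner_symm p q := by simp [bumpInner, mul_right_comm]
  re_inner_nonneg p := by
    rcases eq_or_ne (p : ℝ[X]) 0 with hp | hp
    · simp [bumpInner, hp]
    · exact (bumpInner_self_pos m hp).le
  add_left p q r := by
    simp only [bumpInner, Submodule.coe_add, mul_add, add_mul, eval_add]
    exact intervalIntegral.integral_add (intervalIntegrable_eval _ _ _)
      (intervalIntegrable_eval _ _ _)
  smul_left p q c := by simp [bumpInner]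
  definite p hp := by
    by_contra hne
    exact (bumpInner_self_pos m (fun h => hne (Subtype.ext h))).ne' hp

lemma eventually_abs_eval_le_mul_sqrt_bumpInner (m : ℕ) (L : ℝ[X] →ₗ[ℝ] ℝ[X]) :
    ∀ᶠ C in atTop, ∀ p : ℝ[X], p.natDegree ≤ m → ∀ x ∈ Icc (0 : ℝ) 1,
      |(L p).eval x| ≤ C * √(bumpInner m p p) := by
  obtain ⟨C₀, hC₀⟩ := exists_norm_le_mul_sqrt_inner (bumpCore m)
    ((Polynomial.toContinuousMapOnAlgHom (Icc (0 : ℝ) 1)).toLinearMap ∘ₗ L ∘ₗ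
      (degreeLT ℝ (m + 1)).subtype)
  filter_upwards [eventually_ge_atTop C₀] with C hC p hp x hx
  have hp' : p ∈ degreeLT ℝ (m + 1) :=
    mem_degreeLT.2 (degree_le_of_natDegree_le hp |>.trans_lt (mod_cast m.lt_succ_self))
  calc |(L p).eval x| ≤ _ := ContinuousMap.norm_coe_le_norm
        (Polynomial.toContinuousMapOnAlgHom (Icc (0 : ℝ) 1) (L p)) ⟨x, hx⟩
    _ ≤ C₀ * √(bumpInner m p p) := hC₀ ⟨p, hp'⟩
    _ ≤ C * √(bumpInner m p p) := by gcongr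

end BumpInner

section FlatCorrection

variable {m k : ℕ} {P Q φ ψ : ℝ[X]} {A c d : ℝ}

lemma eval_iterate_derivative_of_pow_dvd {l p : ℝ[X]} {x : ℝ} (h : l ^ (m + 1) ∣ p)
    (hx : l.eval x = 0) (hk : k ≤ m) : (derivative^[k] p).eval x = 0 := by
  have := eval_dvd (x := x) ((dvd_pow_self l (by omega)).trans
    (pow_sub_dvd_iterate_derivative_of_pow_dvd k h))
  rwa [hx, zero_dvd_iff] at this

lemma eval_iterate_derivative_of_bump_dvd (h : bump m ∣ φ) (hk : k ≤ m) :
    (derivative^[k] φ).eval 0 = 0 ∧ (derivative^[k] φ).eval 1 = 0 :=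
  ⟨eval_iterate_derivative_of_pow_dvd (l := X) ((dvd_mul_right _ _).trans h) (by simp) hk,
    eval_iterate_derivative_of_pow_dvd (l := 1 - X) ((dvd_mul_left _ _).trans h) (by simp) hk⟩

/-- The polynomial curve `(P, Q)` on `[0, 1]` can be modified, without affecting the jets of order
`m` at the endpoints, so that its swept area becomes `A`; the derivatives of order `m` change by at
most `c`. -/
def HasFlatCorrection (m : ℕ) (P Q : ℝ[X]) (A c : ℝ) : Prop :=
  ∃ φ ψ : ℝ[X], bump m ∣ φ ∧ bump m ∣ ψ ∧ sweptArea (P + φ).eval (Q + ψ).eval 0 1 = A ∧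
    ∀ x ∈ Icc (0 : ℝ) 1,
      |(derivative^[m] φ).eval x| ≤ c ∧ |(derivative^[m] ψ).eval x| ≤ c

lemma HasFlatCorrection.mono (h : HasFlatCorrection m P Q A c) (hcd : c ≤ d) :
    HasFlatCorrection m P Q A d := by
  obtain ⟨φ, ψ, hφ, hψ, area, bound⟩ := h
  exact ⟨φ, ψ, hφ, hψ, area, fun x hx => ⟨(bound x hx).1.trans hcd, (bound x hx).2.trans hcd⟩⟩

lemma HasFlatCorrection.swap (h : HasFlatCorrection m P Q A c) :
    HasFlatCorrection m Q P (-A) c := by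
  obtain ⟨φ, ψ, hφ, hψ, area, bound⟩ := h
  exact ⟨ψ, φ, hψ, hφ, by rw [sweptArea_swap, area], fun x hx => (bound x hx).symm⟩

lemma sweptArea_eval (P Q : ℝ[X]) (a b : ℝ) : sweptArea P.eval Q.eval a b
    = ∫ x in a..b, (derivative P * Q - derivative Q * P).eval x := by
  simp [sweptArea]

lemma sweptArea_add_of_bump_dvd (hφ : bump m ∣ φ) (hψ : bump m ∣ ψ) :
    sweptArea (P + φ).eval (Q + ψ).eval 0 1 = sweptArea P.eval Q.eval 0 1
      + 2 * (∫ x in (0 : ℝ)..1, (derivative P * ψ - derivative Q * φ).eval x)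
      + sweptArea φ.eval ψ.eval 0 1 := by
  obtain ⟨hφ₀, hφ₁⟩ := eval_iterate_derivative_of_bump_dvd hφ (Nat.zero_le m)
  obtain ⟨hψ₀, hψ₁⟩ := eval_iterate_derivative_of_bump_dvd hψ (Nat.zero_le m)
  have h := sweptArea_add (contDiff_eval P) (contDiff_eval Q) (contDiff_eval φ) (contDiff_eval ψ)
    0 1
  simp only [Function.iterate_zero_apply] at hφ₀ hφ₁ hψ₀ hψ₁
  simp only [hφ₀, hφ₁, hψ₀, hψ₁, zero_mul, sub_zero, add_zero, Polynomial.deriv] at h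
  have eval_add (p q : ℝ[X]) : (p + q).eval = p.eval + q.eval := funext fun _ => eval_add
  simpa only [eval_add, eval_sub, eval_mul] using h

lemma exists_quadratic_eq {κ : ℝ} (hκ : 0 < κ) (β : ℝ) {e : ℝ} (he : 0 ≤ e) :
    ∃ t : ℝ, |t| ≤ √(e / κ) ∧ κ * t ^ 2 + β * t = e := by
  wlog hβ : 0 ≤ β generalizing β
  · obtain ⟨t, ht, eq⟩ := this (-β) (by linarith)
    exact ⟨-t, by rwa [abs_neg], by linarith⟩
  have hs : κ * √(e / κ) ^ 2 = e := by
    rw [Real.sq_sqrt (by positivity)]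
    field_simp
  obtain ⟨t, ht, eq⟩ := intermediate_value_Icc (Real.sqrt_nonneg (e / κ))
    (f := fun t => κ * t ^ 2 + β * t) (by fun_prop) (show e ∈ Icc _ _ from
      ⟨by simpa using he, by simp only [hs]; nlinarith [Real.sqrt_nonneg (e / κ)]⟩)
  exact ⟨t, (abs_of_nonneg ht.1).trans_le ht.2, eq⟩

lemma exists_abs_eval_le (p : ℝ[X]) : ∃ D : ℝ, ∀ x ∈ Icc (0 : ℝ) 1, |p.eval x| ≤ D :=
  isCompact_Icc.exists_bound_of_continuousOn p.continuousOn

lemma hasFlatCorrection_of_quadratic_eq {φ ψ : ℝ[X]} (hφ : bump m ∣ φ) (hψ : bump m ∣ ψ) {D t : ℝ}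
    (eq : sweptArea φ.eval ψ.eval 0 1 * t ^ 2
      + 2 * (∫ x in (0 : ℝ)..1, (derivative P * ψ - derivative Q * φ).eval x) * t
        = A - sweptArea P.eval Q.eval 0 1)
    (hD : ∀ x ∈ Icc (0 : ℝ) 1, |(derivative^[m] φ).eval x| ≤ D ∧ |(derivative^[m] ψ).eval x| ≤ D) :
    HasFlatCorrection m P Q A (|t| * D) := by
  refine ⟨C t * φ, C t * ψ, hφ.mul_left _, hψ.mul_left _, ?_, fun x hx => ?_⟩
  · have linear : ∫ x in (0 : ℝ)..1, (derivative P * (C t * ψ) - derivative Q * (C t * φ)).eval x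
        = t * ∫ x in (0 : ℝ)..1, (derivative P * ψ - derivative Q * φ).eval x := by
      rw [← intervalIntegral.integral_const_mul]
      congr with x
      simp only [eval_sub, eval_mul, eval_C]
      ring
    have square : sweptArea (C t * φ).eval (C t * ψ).eval 0 1
        = t ^ 2 * sweptArea φ.eval ψ.eval 0 1 := by
      rw [sweptArea_eval, sweptArea_eval, ← intervalIntegral.integral_const_mul]
      congr with x
      simp only [derivative_C_mul, eval_sub, eval_mul, eval_C]
      ring
    rw [sweptArea_add_of_bump_dvd (hφ.mul_left _) (hψ.mul_left _), linear, square]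
    linarith
  · simp only [iterate_derivative_C_mul, eval_mul, eval_C, abs_mul]
    exact ⟨by gcongr; exact (hD x hx).1, by gcongr; exact (hD x hx).2⟩

/-- Adding `t * X * bump m` to one component and `t * bump m` to the other makes the swept area a
quadratic polynomial in `t` whose leading coefficient is positive and independent of the curve. -/
lemma exists_hasFlatCorrection_sqrt (m : ℕ) : ∃ C : ℝ, ∀ (P Q : ℝ[X]) (A : ℝ),
    HasFlatCorrection m P Q A (C * √|A - sweptArea P.eval Q.eval 0 1|) := by
  set κ := sweptArea (bump m * X).eval (bump m).eval 0 1
  have hκ : 0 < κ := by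
    have : κ = ∫ x in (0 : ℝ)..1, (bump m ^ 2).eval x := by
      refine (sweptArea_eval _ _ 0 1).trans ?_
      rw [derivative_mul, derivative_X]
      congr with x
      congr 1
      ring
    refine this ▸ intervalIntegral.intervalIntegral_pos_of_pos_on (intervalIntegrable_eval _ _ _)
      (fun x hx => ?_) zero_lt_one
    rw [eval_pow]
    exact pow_pos (bump_pos m hx) 2
  obtain ⟨D₁, hD₁⟩ := exists_abs_eval_le (derivative^[m] (bump m * X))
  obtain ⟨D₂, hD₂⟩ := exists_abs_eval_le (derivative^[m] (bump m))
  have hD : 0 ≤ max D₁ D₂ := le_max_of_le_left ((abs_nonneg _).trans (hD₁ 0 (by simp)))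
  refine ⟨max D₁ D₂ / √κ, fun P Q A => ?_⟩
  wlog hA : 0 ≤ A - sweptArea P.eval Q.eval 0 1 generalizing P Q A
  · have h := (this Q P (-A) (by rw [sweptArea_swap P.eval]; linarith)).swap
    rwa [sweptArea_swap P.eval, neg_neg, neg_sub_neg, abs_sub_comm] at h
  obtain ⟨t, ht, eq⟩ := exists_quadratic_eq hκ
    (2 * ∫ x in (0 : ℝ)..1, (derivative P * bump m - derivative Q * (bump m * X)).eval x) hA
  refine (hasFlatCorrection_of_quadratic_eq (dvd_mul_right _ _) dvd_rfl eq fun x hx =>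
    ⟨(hD₁ x hx).trans (le_max_left _ _), (hD₂ x hx).trans (le_max_right _ _)⟩).mono ?_
  rw [Real.sqrt_div hA] at ht
  calc |t| * max D₁ D₂ ≤ _ := mul_le_mul_of_nonneg_right ht hD
    _ = _ := by rw [abs_of_nonneg hA]; ring

/-- Only one component is modified: this changes the swept area linearly. -/
lemma hasFlatCorrection_of_le_integral {ψ : ℝ[X]} (hψ : bump m ∣ ψ) {κ D : ℝ} (hκ : 0 < κ)
    (hψκ : κ ≤ 2 * ∫ x in (0 : ℝ)..1, (derivative P * ψ).eval x)
    (hD : ∀ x ∈ Icc (0 : ℝ) 1, |(derivative^[m] ψ).eval x| ≤ D) :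
    HasFlatCorrection m P Q A (|A - sweptArea P.eval Q.eval 0 1| / κ * D) := by
  have hD₀ : 0 ≤ D := (abs_nonneg _).trans (hD 0 (by simp))
  set I := 2 * ∫ x in (0 : ℝ)..1, (derivative P * ψ).eval x with hI
  refine (hasFlatCorrection_of_quadratic_eq (t := (A - sweptArea P.eval Q.eval 0 1) / I)
    (dvd_zero _) hψ ?_ fun x hx => ⟨by simpa using hD₀, hD x hx⟩).mono ?_
  · simp only [mul_zero, sub_zero, ← hI]
    have : I ≠ 0 := (hκ.trans_le hψκ).ne'
    simp [sweptArea]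
    field_simp
  · rw [abs_div, abs_of_pos (hκ.trans_le hψκ)]
    gcongr

lemma abs_integral_unit_le {f : ℝ → ℝ} {B : ℝ} (hf : ∀ x ∈ Icc (0 : ℝ) 1, |f x| ≤ B) :
    |∫ x in (0 : ℝ)..1, f x| ≤ B := by
  have h := intervalIntegral.norm_integral_le_of_norm_le_const (a := 0) (b := 1) (C := B) (f := f)
    fun x hx => hf x (Ioc_subset_Icc_self (by rwa [uIoc_of_le zero_le_one] at hx))
  simpa using h

lemma bumpInner_le_integral {R : ℝ[X]}
    (hR : |∫ x in (0 : ℝ)..1, (derivative R * (bump m * derivative P)).eval x|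
      ≤ bumpInner m (derivative P) (derivative P) / 2) :
    bumpInner m (derivative P) (derivative P)
      ≤ 2 * ∫ x in (0 : ℝ)..1, (derivative (P + R) * (bump m * derivative P)).eval x := by
  have split : ∫ x in (0 : ℝ)..1, (derivative (P + R) * (bump m * derivative P)).eval x
      = bumpInner m (derivative P) (derivative P)
        + ∫ x in (0 : ℝ)..1, (derivative R * (bump m * derivative P)).eval x := by
    rw [bumpInner, ← intervalIntegral.integral_add (intervalIntegrable_eval _ _ _)
      (intervalIntegrable_eval _ _ _)]
    congr with x
    rw [← eval_add, derivative_add]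
    congr 1
    ring
  linarith [abs_le.1 hR]

lemma exists_hasFlatCorrection_div (m : ℕ) : ∃ C ε₀ : ℝ, 0 < C ∧ 0 < ε₀ ∧
    ∀ (P R Q : ℝ[X]) (A : ℝ), P.natDegree ≤ m → 0 < ∫ x in (0 : ℝ)..1, |deriv P.eval x| →
      (∀ x ∈ Icc (0 : ℝ) 1,
        |(derivative R).eval x| ≤ ε₀ * ∫ x in (0 : ℝ)..1, |deriv P.eval x|) →
      HasFlatCorrection m (P + R) Q A
        (C * |A - sweptArea (P + R).eval Q.eval 0 1| / ∫ x in (0 : ℝ)..1, |deriv P.eval x|) := by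
  have bound (L : ℝ[X] →ₗ[ℝ] ℝ[X]) := eventually_abs_eval_le_mul_sqrt_bumpInner m L
  obtain ⟨C, hC, hC₁, hC₂, hC₃⟩ := ((eventually_gt_atTop 0).and ((bound .id).and
    ((bound (.mulLeft ℝ (bump m))).and
      (bound ((derivative : Module.End ℝ ℝ[X]) ^ m * .mulLeft ℝ (bump m)))))).exists
  refine ⟨C ^ 2, 1 / (2 * C ^ 2), by positivity, by positivity, fun P R Q A hP hv hR => ?_⟩
  set p := derivative P
  have hp : p.natDegree ≤ m := (natDegree_derivative_le P).trans (by omega)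
  set v := ∫ x in (0 : ℝ)..1, |deriv P.eval x|
  set ν := √(bumpInner m p p)
  have hvν : v ≤ C * ν := (le_abs_self v).trans <| abs_integral_unit_le fun x hx => by
    simpa using hC₁ p hp x hx
  have hν : 0 < ν := pos_of_mul_pos_right (hv.trans_le hvν) hC.le
  have hν2 : ν ^ 2 = bumpInner m p p := Real.sq_sqrt (Real.sqrt_pos.1 hν).le
  have perturbation : |∫ x in (0 : ℝ)..1, (derivative R * (bump m * p)).eval x|
      ≤ bumpInner m p p / 2 :=
    calc _ ≤ 1 / (2 * C ^ 2) * v * (C * ν) := abs_integral_unit_le fun x hx => by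
          rw [eval_mul, abs_mul]
          exact mul_le_mul (hR x hx) (hC₂ p hp x hx) (abs_nonneg _) (by positivity)
      _ ≤ 1 / (2 * C ^ 2) * (C * ν) * (C * ν) := by gcongr
      _ = bumpInner m p p / 2 := by rw [← hν2]; field_simp
  refine (hasFlatCorrection_of_le_integral (dvd_mul_right _ p) (by positivity)
    (hν2 ▸ bumpInner_le_integral perturbation) (D := C * ν) fun x hx => ?_).mono ?_
  · simpa [Module.End.pow_apply] using hC₃ p hp x hx
  · calc |A - sweptArea (P + R).eval Q.eval 0 1| / ν ^ 2 * (C * ν)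
        = C ^ 2 * |A - sweptArea (P + R).eval Q.eval 0 1| / (C * ν) := by field_simp
      _ ≤ _ := by gcongr

lemma eventually_hasFlatCorrection_of_slow (m : ℕ) {η : ℝ} (hη : 0 < η) : ∀ᶠ ε in 𝓝[>] (0 : ℝ),
    ∀ (P Q : ℝ[X]) (A l L : ℝ), 0 < l → L ≤ l →
      |A - sweptArea P.eval Q.eval 0 1| ≤ ε * (l ^ 2 + l * L) →
      HasFlatCorrection m P Q A (η * l) := by
  obtain ⟨C, hC⟩ := exists_hasFlatCorrection_sqrt m
  filter_upwards [eventually_const_mul_le (pow_pos hη 2) (2 * C ^ 2), self_mem_nhdsWithin] with ε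
    hε (hε₀ : 0 < ε) P Q A l L hl hL hA
  refine (hC P Q A).mono ((le_abs_self _).trans (abs_le_of_sq_le_sq ?_ (by positivity)))
  calc (C * √|A - sweptArea P.eval Q.eval 0 1|) ^ 2
      = C ^ 2 * |A - sweptArea P.eval Q.eval 0 1| := by rw [mul_pow, Real.sq_sqrt (abs_nonneg _)]
    _ ≤ C ^ 2 * (ε * (l ^ 2 + l * l)) := by gcongr; exact hA.trans (by gcongr)
    _ = 2 * C ^ 2 * ε * l ^ 2 := by ring
    _ ≤ η ^ 2 * l ^ 2 := by gcongr
    _ = (η * l) ^ 2 := by ring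

lemma eventually_hasFlatCorrection_of_fast (m : ℕ) {η : ℝ} (hη : 0 < η) : ∀ᶠ ε in 𝓝[>] (0 : ℝ),
    ∀ (P R Q : ℝ[X]) (A l L : ℝ), P.natDegree ≤ m → 0 < l → l ≤ L →
      L ≤ 2 * (∫ x in (0 : ℝ)..1, |deriv P.eval x|) →
      (∀ x ∈ Icc (0 : ℝ) 1, |(derivative R).eval x| ≤ ε * l) →
      |A - sweptArea (P + R).eval Q.eval 0 1| ≤ ε * (l ^ 2 + l * L) →
      HasFlatCorrection m (P + R) Q A (η * l) := by
  obtain ⟨C, ε₀, hC, hε₀, fast⟩ := exists_hasFlatCorrection_div m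
  filter_upwards [eventually_const_mul_le hε₀ 2, eventually_const_mul_le hη (4 * C),
    self_mem_nhdsWithin] with ε hε₁ hε₂ (hε : 0 < ε) P R Q A l L hP hl hlL hL hR hA
  have hv := pos_of_mul_pos_right (hl.trans_le (hlL.trans hL)) zero_le_two
  set v := ∫ x in (0 : ℝ)..1, |deriv P.eval x|
  refine (fast P R Q A hP hv fun x hx => (hR x hx).trans ?_).mono ?_
  · calc ε * l ≤ ε * (2 * v) := by gcongr; exact hlL.trans hL
      _ = 2 * ε * v := by ring
      _ ≤ ε₀ * v := by gcongr
  · rw [div_le_iff₀ hv]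
    calc C * |A - sweptArea (P + R).eval Q.eval 0 1|
        ≤ C * (ε * (l * L + l * L)) := by gcongr; exact hA.trans (by rw [sq]; gcongr)
      _ ≤ C * (ε * (l * (2 * v) + l * (2 * v))) := by gcongr
      _ = 4 * C * ε * l * v := by ring
      _ ≤ η * l * v := by gcongr

lemma eventually_hasFlatCorrection (m : ℕ) {η : ℝ} (hη : 0 < η) : ∀ᶠ ε in 𝓝[>] (0 : ℝ),
    ∀ (P Q R S : ℝ[X]) (A l : ℝ), P.natDegree ≤ m → Q.natDegree ≤ m → 0 < l →
      (∀ x ∈ Icc (0 : ℝ) 1, |(derivative R).eval x| ≤ ε * l ∧ |(derivative S).eval x| ≤ ε * l) →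
      |A - sweptArea (P + R).eval (Q + S).eval 0 1|
        ≤ ε * (l ^ 2 + l * pathLength P.eval Q.eval 0 1) →
      HasFlatCorrection m (P + R) (Q + S) A (η * l) := by
  filter_upwards [eventually_hasFlatCorrection_of_slow m hη,
    eventually_hasFlatCorrection_of_fast m hη] with ε slow fast P Q R S A l hP hQ hl hRS hA
  rcases le_total (pathLength P.eval Q.eval 0 1) l with hL | hL
  · exact slow _ _ A l _ hl hL hA
  have length : pathLength P.eval Q.eval 0 1
      = (∫ x in (0 : ℝ)..1, |deriv P.eval x|) + ∫ x in (0 : ℝ)..1, |deriv Q.eval x| :=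
    intervalIntegral.integral_add
      ((contDiff_eval P).continuous_deriv_one.abs.intervalIntegrable _ _)
      ((contDiff_eval Q).continuous_deriv_one.abs.intervalIntegrable _ _)
  rcases le_total (∫ x in (0 : ℝ)..1, |deriv Q.eval x|) (∫ x in (0 : ℝ)..1, |deriv P.eval x|)
    with hPQ | hPQ
  · exact fast P R (Q + S) A l _ hP hl hL (by linarith) (fun x hx => (hRS x hx).1) hA
  · rw [← neg_neg A]
    refine (fast Q S (P + R) (-A) l _ hQ hl hL (by linarith) (fun x hx => (hRS x hx).2) ?_).swap
    rwa [sweptArea_swap (P + R).eval, neg_sub_neg, abs_sub_comm]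

end FlatCorrection

/-! ### Filling a gap -/

/-- By Bézout's identity there is `w` with `w ≡ 0` modulo `X ^ (m + 1)` and `w ≡ 1` modulo
`(X - 1) ^ (m + 1)`. -/
lemma exists_eval_iterate_derivative_mul (m : ℕ) : ∃ w : ℝ[X], ∀ (q : ℝ[X]), ∀ k ≤ m,
    (derivative^[k] (w * q)).eval 0 = 0 ∧
      (derivative^[k] (w * q)).eval 1 = (derivative^[k] q).eval 1 := by
  have coprime : IsCoprime (X ^ (m + 1) : ℝ[X]) ((X - C 1) ^ (m + 1)) :=
    IsCoprime.pow (by simpa using isCoprime_X_sub_C_of_isUnit_sub (R := ℝ) (a := 0) (b := 1))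
  obtain ⟨u, v, huv⟩ := coprime
  refine ⟨u * X ^ (m + 1), fun q k hk => ⟨?_, ?_⟩⟩
  · exact eval_iterate_derivative_of_pow_dvd (l := X)
      ((dvd_mul_left _ _).trans (dvd_mul_right _ _)) (by simp) hk
  · have eq : u * X ^ (m + 1) * q = q - (X - C 1) ^ (m + 1) * (v * q) := by
      linear_combination q * huv
    rw [eq, iterate_derivative_sub, eval_sub,
      eval_iterate_derivative_of_pow_dvd (dvd_mul_right _ _) (by simp) hk, sub_zero]

lemma eventually_abs_eval_sum_le (e : ℕ → ℝ[X]) (m : ℕ) : ∀ᶠ D in atTop, ∀ (v : ℕ → ℝ) (B : ℝ),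
    (∀ j ≤ m, |v j| ≤ B) → ∀ x ∈ Icc (0 : ℝ) 1,
      |(∑ j ∈ Finset.range (m + 1), C (v j) * e j).eval x| ≤ D * B := by
  choose D₀ hD₀ using fun j => exists_abs_eval_le (e j)
  filter_upwards [eventually_ge_atTop (∑ j ∈ Finset.range (m + 1), D₀ j)] with D hD v B hv x hx
  have hB : 0 ≤ B := (abs_nonneg _).trans (hv 0 (Nat.zero_le m))
  calc |(∑ j ∈ Finset.range (m + 1), C (v j) * e j).eval x|
      ≤ ∑ j ∈ Finset.range (m + 1), |v j| * |(e j).eval x| := by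
        simp only [eval_finsetSum, eval_mul, eval_C, ← abs_mul]
        exact Finset.abs_sum_le_sum_abs _ _
    _ ≤ ∑ j ∈ Finset.range (m + 1), B * D₀ j := by
        gcongr with j hj
        exacts [hv j (Finset.mem_range_succ_iff.1 hj), hD₀ j x hx]
    _ ≤ D * B := by
        rw [← Finset.mul_sum, mul_comm]
        gcongr

lemma exists_hermite (m : ℕ) : ∃ D : ℝ, 0 < D ∧ ∀ (v : ℕ → ℝ) (B : ℝ), (∀ j ≤ m, |v j| ≤ B) →
    ∃ R : ℝ[X], (∀ k ≤ m, (derivative^[k] R).eval 0 = 0 ∧ (derivative^[k] R).eval 1 = v k) ∧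
      ∀ k ≤ m, ∀ x ∈ Icc (0 : ℝ) 1, |(derivative^[k] R).eval x| ≤ D * B := by
  obtain ⟨w, hw⟩ := exists_eval_iterate_derivative_mul m
  let e (j : ℕ) : ℝ[X] := w * (C (j.factorial : ℝ)⁻¹ * (X - C 1) ^ j)
  have bound : ∀ᶠ D in atTop, ∀ k ∈ Finset.range (m + 1), ∀ (v : ℕ → ℝ) (B : ℝ),
      (∀ j ≤ m, |v j| ≤ B) → ∀ x ∈ Icc (0 : ℝ) 1,
      |(∑ j ∈ Finset.range (m + 1), C (v j) * derivative^[k] (e j)).eval x| ≤ D * B :=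
    (Finset.eventually_all _).2 fun k _ => eventually_abs_eval_sum_le _ _
  obtain ⟨D, hD, bound⟩ := ((eventually_gt_atTop 0).and bound).exists
  refine ⟨D, hD, fun v B hv => ⟨w * taylorPoly m (fun k _ => v k) 1, fun k hk => ?_,
    fun k hk x hx => ?_⟩⟩
  · rw [(hw _ k hk).1, (hw _ k hk).2, eval_iterate_derivative_taylorPoly_self hk]
    exact ⟨rfl, rfl⟩
  · have eq : w * taylorPoly m (fun k _ => v k) 1 = ∑ j ∈ Finset.range (m + 1), C (v j) * e j := by
      simp only [taylorPoly, e, Finset.mul_sum, div_eq_mul_inv, C_mul]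
      exact Finset.sum_congr rfl fun j _ => by ring
    rw [eq, iterate_derivative_sum]
    simp only [iterate_derivative_C_mul]
    exact bound k (Finset.mem_range_succ_iff.2 hk) v B hv x hx

section Rescaling

variable {m : ℕ} {F G : ℕ → ℝ → ℝ} {a b Δ c c₁ c₂ : ℝ} {R S : ℝ[X]}

lemma eval_iterate_derivative_comp_affine (p : ℝ[X]) (l d : ℝ) (k : ℕ) (x : ℝ) :
    (derivative^[k] (p.comp (C l * X + C d))).eval x
      = l ^ k * (derivative^[k] p).eval (l * x + d) := by
  induction k generalizing p with
  | zero => simp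
  | succ k ih =>
    rw [Function.iterate_succ_apply, derivative_comp]
    simp only [derivative_add, derivative_C_mul, derivative_X, derivative_C, mul_one, add_zero,
      iterate_derivative_C_mul, eval_mul, eval_C, ih, Function.iterate_succ_apply]
    ring

lemma deriv_comp_affine (f : ℝ → ℝ) (l d x : ℝ) :
    deriv (fun x => f (l * x + d)) x = l * deriv f (l * x + d) := by
  rw [deriv_comp_mul_left (f := fun y => f (y + d)), deriv_comp_add_const, smul_eq_mul]

lemma sweptArea_comp_affine (f g : ℝ → ℝ) (l d x y : ℝ) :
    sweptArea (fun x => f (l * x + d)) (fun x => g (l * x + d)) x y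
      = sweptArea f g (l * x + d) (l * y + d) := by
  rw [sweptArea, sweptArea, ← intervalIntegral.mul_integral_comp_mul_add,
    ← intervalIntegral.integral_const_mul]
  congr with t
  rw [deriv_comp_affine, deriv_comp_affine]
  ring

lemma pathLength_comp_affine (f g : ℝ → ℝ) {l : ℝ} (hl : 0 ≤ l) (d x y : ℝ) :
    pathLength (fun x => f (l * x + d)) (fun x => g (l * x + d)) x y
      = pathLength f g (l * x + d) (l * y + d) := by
  rw [pathLength, pathLength, ← intervalIntegral.mul_integral_comp_mul_add,
    ← intervalIntegral.integral_const_mul]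
  congr with t
  rw [deriv_comp_affine, deriv_comp_affine, abs_mul, abs_mul, abs_of_nonneg hl]
  ring

/-- The Taylor polynomial at `a` in the coordinate on `[a, b]` that runs from `0` to `1`. -/
noncomputable def gapTaylor (m : ℕ) (F : ℕ → ℝ → ℝ) (a b : ℝ) : ℝ[X] :=
  (taylorPoly m F a).comp (C (b - a) * X + C a)

lemma natDegree_gapTaylor_le (m : ℕ) (F : ℕ → ℝ → ℝ) (a b : ℝ) :
    (gapTaylor m F a b).natDegree ≤ m := by
  have taylor : (taylorPoly m F a).natDegree ≤ m := by
    refine natDegree_sum_le_of_forall_le _ _ fun k hk => (natDegree_C_mul_le _ _).trans ?_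
    rw [natDegree_pow, natDegree_X_sub_C, mul_one]
    exact Finset.mem_range_succ_iff.1 hk
  rw [gapTaylor]
  refine natDegree_comp_le.trans ((Nat.mul_le_mul taylor ?_).trans_eq (mul_one m))
  exact natDegree_linear_le

lemma eval_iterate_derivative_gapTaylor {k : ℕ} (hk : k ≤ m) (F : ℕ → ℝ → ℝ) (a b : ℝ) :
    (derivative^[k] (gapTaylor m F a b)).eval 0 = (b - a) ^ k * F k a ∧
      (derivative^[k] (gapTaylor m F a b)).eval 1
        = (b - a) ^ k * (F k b - remainder m F a k b) := by
  simp only [gapTaylor, eval_iterate_derivative_comp_affine, mul_zero, zero_add, mul_one,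
    sub_add_cancel, eval_iterate_derivative_taylorPoly_self hk, remainder_eq hk, sub_sub_cancel,
    and_self]

lemma eval_iterate_derivative_gapTaylor_top (m : ℕ) (F : ℕ → ℝ → ℝ) (a b x : ℝ) :
    (derivative^[m] (gapTaylor m F a b)).eval x = (b - a) ^ m * F m a := by
  have top := remainder_top m F a ((b - a) * x + a)
  rw [remainder_eq le_rfl] at top
  rw [gapTaylor, eval_iterate_derivative_comp_affine]
  linear_combination -(b - a) ^ m * top

/-- `R` interpolates, in the coordinate on `[a, b]` that runs from `0` to `1`, between `0` and the
Taylor remainders at `b`. -/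
def IsGapJump (m : ℕ) (F : ℕ → ℝ → ℝ) (a b : ℝ) (R : ℝ[X]) : Prop :=
  ∀ k ≤ m, (derivative^[k] R).eval 0 = 0 ∧
    (derivative^[k] R).eval 1 = (b - a) ^ k * remainder m F a k b

lemma IsGapJump.add_bump {φ : ℝ[X]} (hR : IsGapJump m F a b R) (hφ : bump m ∣ φ) :
    IsGapJump m F a b (R + φ) := by
  intro k hk
  have flat := eval_iterate_derivative_of_bump_dvd hφ hk
  rw [iterate_map_add, eval_add, eval_add, flat.1, flat.2, add_zero, add_zero]
  exact hR k hk

/-- An arc over the gap `[a, b]` that has the prescribed jets at both endpoints and whose derivative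
of order `m` stays within `c` of its value at `a`. -/
structure IsGapArc (m : ℕ) (F : ℕ → ℝ → ℝ) (a b c : ℝ) (Φ : ℝ[X]) : Prop where
  left : ∀ k ≤ m, (derivative^[k] Φ).eval a = F k a
  right : ∀ k ≤ m, (derivative^[k] Φ).eval b = F k b
  osc : ∀ x ∈ Icc a b, |(derivative^[m] Φ).eval x - F m a| ≤ c

/-- The arc over `[a, b]` that deviates by `R` from the Taylor polynomial at `a`. -/
noncomputable def gapArc (m : ℕ) (F : ℕ → ℝ → ℝ) (a b : ℝ) (R : ℝ[X]) : ℝ[X] :=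
  (gapTaylor m F a b + R).comp (C (b - a)⁻¹ * X + C (-((b - a)⁻¹ * a)))

lemma eval_iterate_derivative_gapArc (m : ℕ) (F : ℕ → ℝ → ℝ) (a b : ℝ) (R : ℝ[X]) (k : ℕ) (x : ℝ) :
    (derivative^[k] (gapArc m F a b R)).eval x = ((b - a) ^ k)⁻¹ *
      ((derivative^[k] (gapTaylor m F a b)).eval ((b - a)⁻¹ * (x - a))
        + (derivative^[k] R).eval ((b - a)⁻¹ * (x - a))) := by
  rw [gapArc, eval_iterate_derivative_comp_affine, iterate_map_add, eval_add, inv_pow, mul_sub,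
    ← sub_eq_add_neg]

lemma IsGapJump.isGapArc (hR : IsGapJump m F a b R) (hab : a < b)
    (hc : ∀ x ∈ Icc (0 : ℝ) 1, |(derivative^[m] R).eval x| ≤ c * (b - a) ^ m) :
    IsGapArc m F a b c (gapArc m F a b R) where
  left k hk := by
    have hl : (b - a) ^ k ≠ 0 := pow_ne_zero k (sub_pos.2 hab).ne'
    rw [eval_iterate_derivative_gapArc, sub_self, mul_zero, (hR k hk).1,
      (eval_iterate_derivative_gapTaylor hk F a b).1, add_zero, inv_mul_cancel_left₀ hl]
  right k hk := by
    have hl : b - a ≠ 0 := (sub_pos.2 hab).ne'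
    rw [eval_iterate_derivative_gapArc, inv_mul_cancel₀ hl, (hR k hk).2,
      (eval_iterate_derivative_gapTaylor hk F a b).2, ← mul_add, sub_add_cancel,
      inv_mul_cancel_left₀ (pow_ne_zero k hl)]
  osc x hx := by
    have hl : 0 < b - a := sub_pos.2 hab
    have mem : (b - a)⁻¹ * (x - a) ∈ Icc (0 : ℝ) 1 := by
      refine ⟨mul_nonneg (inv_nonneg.2 hl.le) (sub_nonneg.2 hx.1), ?_⟩
      rw [inv_mul_le_one₀ hl]
      linarith [hx.2]
    rw [eval_iterate_derivative_gapArc, eval_iterate_derivative_gapTaylor_top, mul_add,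
      inv_mul_cancel_left₀ (pow_pos hl m).ne', add_sub_cancel_left, abs_mul, abs_inv,
      abs_of_pos (pow_pos hl m), inv_mul_le_iff₀ (pow_pos hl m), mul_comm _ c]
    exact hc _ mem

lemma sweptArea_gapArc (m : ℕ) (F G : ℕ → ℝ → ℝ) (hab : a < b) (R S : ℝ[X]) :
    sweptArea (gapArc m F a b R).eval (gapArc m G a b S).eval a b
      = sweptArea (gapTaylor m F a b + R).eval (gapTaylor m G a b + S).eval 0 1 := by
  have hl : b - a ≠ 0 := (sub_pos.2 hab).ne'
  have eval_gapArc (F : ℕ → ℝ → ℝ) (R : ℝ[X]) : (gapArc m F a b R).eval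
      = fun x => (gapTaylor m F a b + R).eval ((b - a)⁻¹ * x + -((b - a)⁻¹ * a)) := by
    ext x
    simp only [gapArc, eval_comp, eval_add, eval_mul, eval_C, eval_X]
  have start : (b - a)⁻¹ * a + -((b - a)⁻¹ * a) = 0 := by ring
  have finish : (b - a)⁻¹ * b + -((b - a)⁻¹ * a) = 1 := by
    rw [← sub_eq_add_neg, ← mul_sub, inv_mul_cancel₀ hl]
  rw [eval_gapArc, eval_gapArc, sweptArea_comp_affine (gapTaylor m F a b + R).eval
    (gapTaylor m G a b + S).eval, start, finish]

/-- The gap `[a, b]` can be filled by a plane curve that sweeps the area `Δ` and whose derivatives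
of order `m` vary by at most `c`. -/
def HasGapFill (m : ℕ) (F G : ℕ → ℝ → ℝ) (a b Δ c : ℝ) : Prop :=
  ∃ Φ Ψ : ℝ[X], IsGapArc m F a b c Φ ∧ IsGapArc m G a b c Ψ ∧
    sweptArea Φ.eval Ψ.eval a b = Δ

lemma HasFlatCorrection.hasGapFill
    (h : HasFlatCorrection m (gapTaylor m F a b + R) (gapTaylor m G a b + S) Δ
      (c₂ * (b - a) ^ m)) (hab : a < b) (hR : IsGapJump m F a b R) (hS : IsGapJump m G a b S)
    (hRc : ∀ x ∈ Icc (0 : ℝ) 1, |(derivative^[m] R).eval x| ≤ c₁ * (b - a) ^ m)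
    (hSc : ∀ x ∈ Icc (0 : ℝ) 1, |(derivative^[m] S).eval x| ≤ c₁ * (b - a) ^ m) :
    HasGapFill m F G a b Δ (c₁ + c₂) := by
  obtain ⟨φ, ψ, hφ, hψ, area, bound⟩ := h
  have add_le {R φ : ℝ[X]} {x : ℝ} (hR : |(derivative^[m] R).eval x| ≤ c₁ * (b - a) ^ m)
      (hφ : |(derivative^[m] φ).eval x| ≤ c₂ * (b - a) ^ m) :
      |(derivative^[m] (R + φ)).eval x| ≤ (c₁ + c₂) * (b - a) ^ m := by
    rw [iterate_map_add, eval_add, add_mul]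
    exact (abs_add_le _ _).trans (add_le_add hR hφ)
  refine ⟨gapArc m F a b (R + φ), gapArc m G a b (S + ψ),
    (hR.add_bump hφ).isGapArc hab fun x hx => add_le (hRc x hx) (bound x hx).1,
    (hS.add_bump hψ).isGapArc hab fun x hx => add_le (hSc x hx) (bound x hx).2, ?_⟩
  rw [sweptArea_gapArc m F G hab, ← add_assoc, ← add_assoc, area]

end Rescaling

section GapFill

variable {m : ℕ} {K : Set ℝ} {F G H : ℕ → ℝ → ℝ} {a b c Δ : ℝ}

lemma HasGapFill.nonneg (h : HasGapFill m F G a b Δ c) (hab : a ≤ b) : 0 ≤ c := by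
  obtain ⟨Φ, -, hΦ, -⟩ := h
  exact (abs_nonneg _).trans (hΦ.osc a (left_mem_Icc.2 hab))

lemma exists_hasGapFill (m : ℕ) (F G : ℕ → ℝ → ℝ) (hab : a < b) (Δ : ℝ) :
    ∃ c, HasGapFill m F G a b Δ c := by
  have hl : 0 < (b - a) ^ m := pow_pos (sub_pos.2 hab) m
  obtain ⟨D, -, hermite⟩ := exists_hermite m
  obtain ⟨C, sqrt⟩ := exists_hasFlatCorrection_sqrt m
  obtain ⟨B, hB⟩ := ((finite_Iic m).image fun k => max |(b - a) ^ k * remainder m F a k b|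
    |(b - a) ^ k * remainder m G a k b|).bddAbove
  have bound (k) (hk : k ≤ m) := max_le_iff.1 (hB (mem_image_of_mem _ (mem_Iic.2 hk)))
  obtain ⟨R, hR, hRB⟩ := hermite _ B fun k hk => (bound k hk).1
  obtain ⟨S, hS, hSB⟩ := hermite _ B fun k hk => (bound k hk).2
  have rescale (x : ℝ) : x = x / (b - a) ^ m * (b - a) ^ m := (div_mul_cancel₀ x hl.ne').symm
  exact ⟨_, (rescale (C * _) ▸ sqrt (gapTaylor m F a b + R) (gapTaylor m G a b + S) Δ).hasGapFill
    hab hR hS (rescale (D * B) ▸ hRB m le_rfl) (rescale (D * B) ▸ hSB m le_rfl)⟩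

lemma pathLength_gapTaylor (m : ℕ) (F G : ℕ → ℝ → ℝ) (hab : a ≤ b) :
    pathLength (gapTaylor m F a b).eval (gapTaylor m G a b).eval 0 1
      = pathLength (taylorPoly m F a).eval (taylorPoly m G a).eval a b := by
  have := pathLength_comp_affine (taylorPoly m F a).eval (taylorPoly m G a).eval
    (sub_nonneg.2 hab) a 0 1
  simpa [gapTaylor] using this

lemma sweptArea_gapTaylor (m : ℕ) (F G : ℕ → ℝ → ℝ) (a b : ℝ) :
    sweptArea (gapTaylor m F a b).eval (gapTaylor m G a b).eval 0 1
      = sweptArea (taylorPoly m F a).eval (taylorPoly m G a).eval a b := by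
  have := sweptArea_comp_affine (taylorPoly m F a).eval (taylorPoly m G a).eval (b - a) a 0 1
  simpa [gapTaylor] using this

lemma abs_half_rise_sub_sweptArea_le (H : ℕ → ℝ → ℝ) {R S : ℝ[X]} {M : ℝ}
    (hR : IsGapJump m F a b R) (hS : IsGapJump m G a b S)
    (hR₀ : ∀ x ∈ Icc (0 : ℝ) 1, |R.eval x| ≤ M) (hS₀ : ∀ x ∈ Icc (0 : ℝ) 1, |S.eval x| ≤ M)
    (hR₁ : ∀ x ∈ Icc (0 : ℝ) 1, |(derivative R).eval x| ≤ M)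
    (hS₁ : ∀ x ∈ Icc (0 : ℝ) 1, |(derivative S).eval x| ≤ M) :
    |(H 0 b - H 0 a) / 2 - sweptArea (gapTaylor m F a b + R).eval (gapTaylor m G a b + S).eval 0 1|
      ≤ |areaDiscrepancy m F G H a b| / 2 + 3 * M
        * pathLength (gapTaylor m F a b).eval (gapTaylor m G a b).eval 0 1 + 2 * M * M := by
  obtain ⟨R_zero, R_one⟩ := hR 0 (Nat.zero_le m)
  obtain ⟨S_zero, S_one⟩ := hS 0 (Nat.zero_le m)
  have F_zero := (eval_iterate_derivative_gapTaylor (Nat.zero_le m) F a b).1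
  have G_zero := (eval_iterate_derivative_gapTaylor (Nat.zero_le m) G a b).1
  simp only [Function.iterate_zero_apply, pow_zero, one_mul] at *
  have perturb := abs_sweptArea_add_sub_le (contDiff_eval (gapTaylor m F a b))
    (contDiff_eval (gapTaylor m G a b)) (contDiff_eval R) (contDiff_eval S) zero_le_one R_zero
    S_zero hR₀ hS₀ (by simpa using hR₁) (by simpa using hS₁)
  rw [sweptArea_gapTaylor, R_one, S_one, F_zero, G_zero, sub_zero, mul_one] at perturb
  have sum_eval (p q : ℝ[X]) : (p + q).eval = p.eval + q.eval := funext fun _ => eval_add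
  have split : (H 0 b - H 0 a) / 2
      - sweptArea (gapTaylor m F a b + R).eval (gapTaylor m G a b + S).eval 0 1
      = areaDiscrepancy m F G H a b / 2
        - (sweptArea ((gapTaylor m F a b).eval + R.eval) ((gapTaylor m G a b).eval + S.eval) 0 1
          - (sweptArea (taylorPoly m F a).eval (taylorPoly m G a).eval a b
            + remainder m F a 0 b * G 0 a - remainder m G a 0 b * F 0 a)) := by
    rw [areaDiscrepancy_eq, sum_eval, sum_eval]
    ring
  rw [split, add_assoc]
  refine (abs_sub _ _).trans (add_le_add ?_ perturb)
  rw [abs_div, abs_two]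

lemma exists_isGapJump (m : ℕ) : ∃ D : ℝ, 0 < D ∧ ∀ (F : ℕ → ℝ → ℝ) {a b ε : ℝ}, a < b →
    (∀ k ≤ m, |remainder m F a k b| ≤ ε * (b - a) ^ (m - k)) →
    ∃ R, IsGapJump m F a b R ∧
      ∀ k ≤ m, ∀ x ∈ Icc (0 : ℝ) 1, |(derivative^[k] R).eval x| ≤ D * (ε * (b - a) ^ m) := by
  obtain ⟨D, hD, hermite⟩ := exists_hermite m
  refine ⟨D, hD, fun F a b ε hab hε => hermite _ _ fun k hk => ?_⟩
  calc |(b - a) ^ k * remainder m F a k b|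
      = (b - a) ^ k * |remainder m F a k b| := by
        rw [abs_mul, abs_of_pos (pow_pos (sub_pos.2 hab) k)]
    _ ≤ (b - a) ^ k * (ε * (b - a) ^ (m - k)) := by
        have := sub_pos.2 hab
        gcongr
        exact hε k hk
    _ = ε * (b - a) ^ m := by rw [mul_left_comm, pow_mul_pow_sub _ hk]

lemma abs_half_rise_sub_sweptArea_le_mul {R S : ℝ[X]} {D ε : ℝ} (hm : 1 ≤ m) (hab : a < b)
    (hD : 0 ≤ D) (hε : ε ∈ Icc 0 1) (hR : IsGapJump m F a b R) (hS : IsGapJump m G a b S)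
    (R_le : ∀ k ≤ m, ∀ x ∈ Icc (0 : ℝ) 1, |(derivative^[k] R).eval x| ≤ D * (ε * (b - a) ^ m))
    (S_le : ∀ k ≤ m, ∀ x ∈ Icc (0 : ℝ) 1, |(derivative^[k] S).eval x| ≤ D * (ε * (b - a) ^ m))
    (hA : |areaDiscrepancy m F G H a b| ≤ ε * velocity m F G a b) :
    |(H 0 b - H 0 a) / 2 - sweptArea (gapTaylor m F a b + R).eval (gapTaylor m G a b + S).eval 0 1|
      ≤ (1 + 3 * D + 2 * D ^ 2) * ε * (((b - a) ^ m) ^ 2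
        + (b - a) ^ m * pathLength (gapTaylor m F a b).eval (gapTaylor m G a b).eval 0 1) := by
  obtain ⟨hε₀, hε₁⟩ := hε
  refine (abs_half_rise_sub_sweptArea_le H hR hS (R_le 0 (Nat.zero_le m)) (S_le 0 (Nat.zero_le m))
    (R_le 1 hm) (S_le 1 hm)).trans ?_
  rw [velocity_eq, ← pathLength_gapTaylor m F G hab.le, mul_comm 2 m, pow_mul] at hA
  set l := (b - a) ^ m
  set L := pathLength (gapTaylor m F a b).eval (gapTaylor m G a b).eval 0 1
  have hlL : 0 ≤ l * L :=
    mul_nonneg (pow_nonneg (sub_nonneg.2 hab.le) m) (pathLength_nonneg _ _ zero_le_one)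
  have hV : 0 ≤ l ^ 2 + l * L := by positivity
  calc |areaDiscrepancy m F G H a b| / 2 + 3 * (D * (ε * l)) * L + 2 * (D * (ε * l)) * (D * (ε * l))
      ≤ ε * (l ^ 2 + l * L) + 3 * (D * ε) * (l * L) + 2 * (D ^ 2 * ε) * (ε * l ^ 2) := by
        linarith [mul_nonneg hε₀ hV]
    _ ≤ ε * (l ^ 2 + l * L) + 3 * (D * ε) * (l ^ 2 + l * L)
        + 2 * (D ^ 2 * ε) * (l ^ 2 + l * L) := by
        gcongr
        · exact le_add_of_nonneg_left (sq_nonneg l)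
        · exact (mul_le_of_le_one_left (sq_nonneg l) hε₁).trans (le_add_of_nonneg_right hlL)
    _ = (1 + 3 * D + 2 * D ^ 2) * ε * (l ^ 2 + l * L) := by ring

lemma eventually_hasGapFill (hm : 1 ≤ m) (hF : IsWhitneyField m K F) (hG : IsWhitneyField m K G)
    (hA : (fun p => areaDiscrepancy m F G H p.1 p.2) =o[shortIntervals K]
      fun p => velocity m F G p.1 p.2) {η : ℝ} (hη : 0 < η) :
    ∀ᶠ p in shortIntervals K, HasGapFill m F G p.1 p.2 ((H 0 p.2 - H 0 p.1) / 2) η := by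
  obtain ⟨D, hD, jump⟩ := exists_isGapJump m
  obtain ⟨ε', flat, hε'⟩ :=
    ((eventually_hasFlatCorrection m (half_pos hη)).and self_mem_nhdsWithin).exists
  obtain ⟨ε, ⟨⟨hεε', hεη⟩, hε1⟩, hε⟩ := ((((eventually_const_mul_le hε'
    (1 + 3 * D + 2 * D ^ 2)).and (eventually_const_mul_le (half_pos hη) D)).and
    ((eventually_le_nhds one_pos).filter_mono nhdsWithin_le_nhds)).and self_mem_nhdsWithin).exists
  filter_upwards [eventually_mem_shortIntervals K,
    hF.eventually_abs_remainder_le hε,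
    hG.eventually_abs_remainder_le hε, hA.def hε] with ⟨a, b⟩ ⟨_, _, hab⟩ wF wG hA
  dsimp only at *
  rw [Real.norm_eq_abs, Real.norm_of_nonneg (velocity_pos m F G hab).le] at hA
  have hl : 0 < (b - a) ^ m := pow_pos (sub_pos.2 hab) m
  obtain ⟨R, hR, R_le⟩ := jump F hab wF
  obtain ⟨S, hS, S_le⟩ := jump G hab wG
  have area := abs_half_rise_sub_sweptArea_le_mul hm hab hD.le ⟨hε.le, hε1⟩ hR hS R_le S_le hA
  have slope : D * (ε * (b - a) ^ m) ≤ ε' * (b - a) ^ m := by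
    rw [← mul_assoc]
    gcongr
    nlinarith [mul_nonneg (sq_nonneg D) hε.le, mul_pos hD hε]
  have top : D * (ε * (b - a) ^ m) ≤ η / 2 * (b - a) ^ m := by
    rw [← mul_assoc]
    gcongr
  rw [← add_halves η]
  refine (flat _ _ R S _ _ (natDegree_gapTaylor_le m F a b) (natDegree_gapTaylor_le m G a b) hl
    (fun x hx => ⟨(R_le 1 hm x hx).trans slope, (S_le 1 hm x hx).trans slope⟩)
    (area.trans ?_)).hasGapFill hab hR hS (fun x hx => (R_le m le_rfl x hx).trans top)
    fun x hx => (S_le m le_rfl x hx).trans top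
  have := pathLength_nonneg (gapTaylor m F a b).eval (gapTaylor m G a b).eval zero_le_one
  gcongr

lemma exists_tendsto_zero {ι : Type*} {u : Filter ι} {P : ι → ℝ → Prop} {s : ι → ℝ}
    (hs : Tendsto s u (𝓝 0)) (hs₀ : ∀ i, 0 < s i) (hP : ∀ i, ∃ c, P i c)
    (nonneg : ∀ i c, P i c → 0 ≤ c) (small : ∀ η : ℝ, 0 < η → ∀ᶠ i in u, P i η) :
    ∃ c : ι → ℝ, (∀ i, P i (c i)) ∧ Tendsto c u (𝓝 0) := by
  choose c hc hlt using fun i => exists_lt_of_csInf_lt (hP i) (lt_add_of_pos_right _ (hs₀ i))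
  refine ⟨c, hc, Metric.tendsto_nhds.2 fun η hη => ?_⟩
  filter_upwards [small _ (half_pos hη), hs.eventually_lt_const (half_pos hη)] with i hi hsi
  have hinf : sInf (P i) ≤ η / 2 := csInf_le ⟨0, nonneg i⟩ hi
  rw [Real.dist_0_eq_abs, abs_of_nonneg (nonneg i _ (hc i))]
  linarith [hlt i]

end GapFill

/-! ### Gaps of a compact set and gluing -/

/-- A gap of `K`: a bounded open interval that misses `K` and has both endpoints in `K`. When `K` is
closed these are the bounded components of its complement. -/
structure Gap (K : Set ℝ) where
  left : ℝ
  right : ℝ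
  left_mem : left ∈ K
  right_mem : right ∈ K
  lt : left < right
  notMem : ∀ x ∈ Ioo left right, x ∉ K

section Gap

variable {K : Set ℝ} {c d x : ℝ}

lemma Gap.eq_of_mem {i j : Gap K} (hi : x ∈ Icc i.left i.right) (hj : x ∈ Ioo j.left j.right) :
    i = j := by
  have left_eq : i.left = j.left :=
    le_antisymm (not_lt.1 fun h => j.notMem _ ⟨h, hi.1.trans_lt hj.2⟩ i.left_mem)
      (not_lt.1 fun h => i.notMem _ ⟨h, hj.1.trans_le hi.2⟩ j.left_mem)
  have right_eq : i.right = j.right :=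
    le_antisymm (not_lt.1 fun h => i.notMem _ ⟨hi.1.trans_lt hj.2, h⟩ j.right_mem)
      (not_lt.1 fun h => j.notMem _ ⟨hj.1.trans_le hi.2, h⟩ i.right_mem)
  cases i
  cases j
  congr

lemma Gap.pairwise_disjoint (K : Set ℝ) :
    Pairwise (Function.onFun Disjoint fun i : Gap K => Ioo i.left i.right) :=
  fun _ _ hij => disjoint_left.2 fun _ hi hj => hij (Gap.eq_of_mem (Ioo_subset_Icc_self hi) hj)

lemma exists_gap_of_notMem (hK : IsClosed K) (hc : c ∈ K) (hd : d ∈ K) (hx : x ∈ Icc c d)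
    (hxK : x ∉ K) : ∃ i : Gap K, x ∈ Ioo i.left i.right := by
  obtain ⟨a, ⟨haK, ha⟩, hmax⟩ := (isCompact_Icc.inter_left hK).exists_isGreatest
    (⟨c, hc, le_rfl, hx.1⟩ : (K ∩ Icc c x).Nonempty)
  obtain ⟨b, ⟨hbK, hb⟩, hmin⟩ := (isCompact_Icc.inter_left hK).exists_isLeast
    (⟨d, hd, hx.2, le_rfl⟩ : (K ∩ Icc x d).Nonempty)
  have hax : a < x := ha.2.lt_of_ne (ne_of_mem_of_not_mem haK hxK)
  have hxb : x < b := hb.1.lt_of_ne' (ne_of_mem_of_not_mem hbK hxK)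
  refine ⟨⟨a, b, haK, hbK, hax.trans hxb, fun z hz hzK => ?_⟩, hax, hxb⟩
  rcases le_total z x with h | h
  · exact hz.1.not_ge (hmax ⟨hzK, ha.1.trans hz.1.le, h⟩)
  · exact hz.2.not_ge (hmin ⟨hzK, h, hz.2.le.trans hb.2⟩)

lemma tendsto_gap_length (hK : Bornology.IsBounded K) :
    Tendsto (fun i : Gap K => i.right - i.left) cofinite (𝓝 0) := by
  have union_subset : ⋃ i : Gap K, Ioo i.left i.right ⊆ Icc (sInf K) (sSup K) :=
    iUnion_subset fun i => Ioo_subset_Icc_self.trans (Icc_subset_Icc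
      (hK.subset_Icc_sInf_sSup i.left_mem).1 (hK.subset_Icc_sInf_sSup i.right_mem).2)
  refine Metric.tendsto_nhds.2 fun ε hε => ?_
  have finite := MeasureTheory.Measure.finite_const_le_meas_of_disjoint_iUnion
    MeasureTheory.volume (ENNReal.ofReal_pos.2 hε) (fun _ => measurableSet_Ioo)
    (Gap.pairwise_disjoint K) (MeasureTheory.measure_ne_top_of_subset union_subset (by simp))
  filter_upwards [finite.compl_mem_cofinite] with i hi
  rw [Real.dist_0_eq_abs, abs_of_pos (sub_pos.2 i.lt)]
  simpa [Real.volume_Ioo, ENNReal.ofReal_le_ofReal_iff (sub_pos.2 i.lt).le] using hi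

lemma tendsto_gap_shortIntervals (hK : Bornology.IsBounded K) :
    Tendsto (fun i : Gap K => (i.left, i.right)) cofinite (shortIntervals K) := by
  refine tendsto_inf.2 ⟨Metric.uniformity_basis_dist.tendsto_right_iff.2 fun ε hε => ?_,
    tendsto_principal.2 <| .of_forall fun i => ⟨i.left_mem, i.right_mem, i.lt⟩⟩
  filter_upwards [(tendsto_gap_length hK).eventually_lt_const hε] with i hi
  rwa [dist_comm, Real.dist_eq, abs_of_pos (sub_pos.2 i.lt)]

end Gap

section Patch

lemma continuous_finsum_of_pairwise_disjoint_support {ι X : Type*} [TopologicalSpace X]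
    {v : ι → X → ℝ} (hv : ∀ i, Continuous (v i))
    (disj : Pairwise (Function.onFun Disjoint fun i => Function.support (v i)))
    (small : ∀ ε : ℝ, 0 < ε → ∀ᶠ i in cofinite, ∀ x, |v i x| < ε) :
    Continuous fun x => ∑ᶠ i, v i x := by
  classical
  refine continuous_of_uniform_approx_of_continuous fun V hV => ?_
  obtain ⟨ε, hε, hεV⟩ := Metric.mem_uniformity_dist.1 hV
  set s := (eventually_cofinite.1 (small ε hε)).toFinset with hs
  refine ⟨fun x => ∑ i ∈ s, v i x, continuous_finsetSum _ fun i _ => hv i, fun x => hεV ?_⟩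
  by_cases hx : ∃ i, v i x ≠ 0
  · obtain ⟨i, hi⟩ := hx
    have vanish (j : ι) (hj : j ≠ i) : v j x = 0 := by
      by_contra h
      exact disjoint_left.1 (disj hj) h hi
    dsimp only
    rw [finsum_eq_single _ i vanish]
    by_cases his : i ∈ s
    · rwa [Finset.sum_eq_single_of_mem i his fun j _ => vanish j, dist_self]
    · rw [Finset.sum_eq_zero fun j hj => vanish j (ne_of_mem_of_not_mem hj his),
        Real.dist_0_eq_abs]
      simp only [hs, Finite.mem_toFinset, mem_ofPred_eq, not_not] at his
      exact his x
  · push Not at hx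
    simpa [hx] using hε

variable {K : Set ℝ}

lemma exists_continuous_eqOn_gap {v : Gap K → ℝ → ℝ} (hv : ∀ i, Continuous (v i))
    (v_zero : ∀ i, ∀ x ∉ Ioo i.left i.right, v i x = 0)
    (small : ∀ ε : ℝ, 0 < ε → ∀ᶠ i in cofinite, ∀ x, |v i x| < ε) :
    ∃ ψ : ℝ → ℝ, Continuous ψ ∧ EqOn ψ 0 K ∧ ∀ i : Gap K, EqOn ψ (v i) (Icc i.left i.right) := by
  have support_subset (i : Gap K) : Function.support (v i) ⊆ Ioo i.left i.right :=
    fun x => not_imp_comm.1 (v_zero i x)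
  refine ⟨fun x => ∑ᶠ i, v i x, continuous_finsum_of_pairwise_disjoint_support hv
    (fun i j hij => (Gap.pairwise_disjoint K hij).mono (support_subset i) (support_subset j)) small,
    fun x hx => ?_, fun i x hx => ?_⟩
  · exact finsum_eq_zero_of_forall_eq_zero fun i => v_zero i x fun h => i.notMem x h hx
  · exact finsum_eq_single _ i fun j hj => v_zero j x fun h => hj (Gap.eq_of_mem hx h).symm

lemma exists_continuous_patch (hK : IsCompact K) {u : ℝ → ℝ} (hu : ContinuousOn u K)
    {w : Gap K → ℝ → ℝ} (hw : ∀ i, Continuous (w i)) (left : ∀ i, w i i.left = u i.left)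
    (right : ∀ i, w i i.right = u i.right) {c : Gap K → ℝ}
    (osc : ∀ i, ∀ x ∈ Icc i.left i.right, |w i x - u i.left| ≤ c i)
    (hc : Tendsto c cofinite (𝓝 0)) :
    ∃ φ : ℝ → ℝ, Continuous φ ∧ EqOn φ u K ∧ ∀ i : Gap K, EqOn φ (w i) (Icc i.left i.right) := by
  obtain ⟨U, hU⟩ := ContinuousMap.exists_restrict_eq hK.isClosed ⟨_, hu.domRestrict⟩
  replace hU : EqOn U u K := fun x hx => DFunLike.congr_fun hU ⟨x, hx⟩
  let v (i : Gap K) : ℝ → ℝ := IccExtend i.lt.le ((Icc i.left i.right).domRestrict (w i - ⇑U))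
  have hv (i : Gap K) : Continuous (v i) :=
    ((hw i).sub U.continuous).continuousOn.domRestrict.Icc_extend'
  have v_zero (i : Gap K) (x : ℝ) (hx : x ∉ Ioo i.left i.right) : v i x = 0 := by
    rcases le_or_gt x i.left with h | h
    · simp [v, IccExtend_of_le_left _ _ h, left, hU i.left_mem]
    · simp [v, IccExtend_of_right_le _ _ (not_lt.1 fun h' => hx ⟨h, h'⟩), right, hU i.right_mem]
  have small (ε : ℝ) (hε : 0 < ε) : ∀ᶠ i in cofinite, ∀ x, |v i x| < ε := by
    obtain ⟨δ, hδ, uniform⟩ := Metric.uniformContinuousOn_iff.1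
      (isCompact_Icc.uniformContinuousOn_of_continuous
        (U.continuous.continuousOn (s := Icc (sInf K) (sSup K)))) (ε / 2) (half_pos hε)
    have subset := hK.isBounded.subset_Icc_sInf_sSup
    filter_upwards [hc.eventually_lt_const (half_pos hε),
      (tendsto_gap_length hK.isBounded).eventually_lt_const hδ] with i hci hli x
    set y := projIcc i.left i.right i.lt.le x
    have near : |U i.left - U y| < ε / 2 := uniform _ (subset i.left_mem) _
      ⟨(subset i.left_mem).1.trans y.2.1, y.2.2.trans (subset i.right_mem).2⟩ <| by
        rw [dist_comm, Real.dist_eq, abs_of_nonneg (sub_nonneg.2 y.2.1)]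
        linarith [y.2.2]
    calc |w i y - U y| = |(w i y - u i.left) + (U i.left - U y)| := by
          rw [hU i.left_mem, sub_add_sub_cancel]
      _ ≤ |w i y - u i.left| + |U i.left - U y| := abs_add_le _ _
      _ < ε := by linarith [osc i y y.2]
  obtain ⟨ψ, hψ, ψ_zero, ψ_eq⟩ := exists_continuous_eqOn_gap hv v_zero small
  refine ⟨U + ψ, U.continuous.add hψ, fun x hx => by simp [hU hx, ψ_zero hx], fun i x hx => ?_⟩
  simp [ψ_eq i hx, v, IccExtend_of_mem i.lt.le _ hx]

end Patch

section ClosedSetDerivative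

variable {K : Set ℝ} {D : ℝ → ℝ} {x y : ℝ}

lemma exists_collapse_gaps (K : Set ℝ) : ∃ ρ : ℝ → ℝ, (∀ x ∈ K, ρ x = x) ∧
    ∀ i : Gap K, ∀ x ∈ Ioo i.left i.right, ρ x = i.left := by
  classical
  refine ⟨fun x => if h : ∃ i : Gap K, x ∈ Ioo i.left i.right then h.choose.left else x,
    fun x hx => dif_neg fun ⟨i, hi⟩ => i.notMem x hi hx, fun i x hx => ?_⟩
  have h : ∃ i : Gap K, x ∈ Ioo i.left i.right := ⟨i, hx⟩
  exact (dif_pos h).trans (by rw [Gap.eq_of_mem (Ioo_subset_Icc_self h.choose_spec) hx])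

lemma hasDerivWithinAt_zero_of_between {E : ℝ → ℝ} {I : Set ℝ} (hD : HasDerivWithinAt D 0 K x)
    (hE : E x = D x) (between : ∀ z ∈ I, ∃ t ∈ K ∩ uIcc x z, E z = D t) :
    HasDerivWithinAt E 0 I x := by
  rw [hasDerivWithinAt_iff_isLittleO] at *
  simp only [smul_zero, sub_zero, hE, isLittleO_iff] at *
  intro ε hε
  obtain ⟨δ, hδ, ball⟩ := Metric.mem_nhdsWithin_iff.1 (hD hε)
  refine Metric.mem_nhdsWithin_iff.2 ⟨δ, hδ, fun z ⟨hzδ, hz⟩ => ?_⟩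
  obtain ⟨t, ⟨htK, ht⟩, hzt⟩ := between z hz
  have htz : |t - x| ≤ |z - x| := abs_sub_left_of_mem_uIcc ht
  calc ‖E z - D x‖ = ‖D t - D x‖ := by rw [hzt]
    _ ≤ ε * |t - x| := ball ⟨htz.trans_lt hzδ, htK⟩
    _ ≤ ε * |z - x| := by gcongr

/-- Collapsing every gap to its left endpoint extends `D` to the whole interval. The extension still
has zero derivative, since between a point of `K` and any `z` there is a point of `K` at which `D`
takes the value assigned to `z`. -/
lemma eq_of_hasDerivWithinAt_zero (hK : IsClosed K) (hD : ∀ z ∈ K, HasDerivWithinAt D 0 K z)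
    (gap : ∀ i : Gap K, D i.right = D i.left) (hx : x ∈ K) (hy : y ∈ K) (hxy : x ≤ y) :
    D y = D x := by
  obtain ⟨ρ, ρ_self, ρ_gap⟩ := exists_collapse_gaps K
  have between (a : ℝ) (ha : a ∈ K) (z : ℝ) (hz : z ∈ Icc x y) :
      ∃ t ∈ K ∩ uIcc a z, D (ρ z) = D t := by
    by_cases hzK : z ∈ K
    · exact ⟨z, ⟨hzK, right_mem_uIcc⟩, by rw [ρ_self z hzK]⟩
    obtain ⟨i, hi⟩ := exists_gap_of_notMem hK hx hy hz hzK
    rw [ρ_gap i z hi]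
    rcases le_or_gt a i.left with h | h
    · exact ⟨i.left, ⟨i.left_mem, mem_uIcc_of_le h hi.1.le⟩, rfl⟩
    · have : i.right ≤ a := not_lt.1 fun h' => i.notMem a ⟨h, h'⟩ ha
      exact ⟨i.right, ⟨i.right_mem, mem_uIcc_of_ge hi.2.le this⟩, (gap i).symm⟩
  have deriv_zero (z : ℝ) (hz : z ∈ Icc x y) : HasDerivWithinAt (D ∘ ρ) 0 (Icc x y) z := by
    by_cases hzK : z ∈ K
    · exact hasDerivWithinAt_zero_of_between (hD z hzK) (congrArg D (ρ_self z hzK))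
        (between z hzK)
    · obtain ⟨i, hi⟩ := exists_gap_of_notMem hK hx hy hz hzK
      refine ((hasDerivAt_const z (D i.left)).congr_of_eventuallyEq ?_).hasDerivWithinAt
      filter_upwards [Ioo_mem_nhds hi.1 hi.2] with t ht
      exact congrArg D (ρ_gap i t ht)
  have const := constant_of_derivWithin_zero (fun z hz => (deriv_zero z hz).differentiableWithinAt)
    (fun z hz => (deriv_zero z (Ico_subset_Icc_self hz)).derivWithin
      (uniqueDiffOn_Icc (hz.1.trans_lt hz.2) z (Ico_subset_Icc_self hz))) y (right_mem_Icc.2 hxy)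
  simpa [ρ_self x hx, ρ_self y hy] using const

lemma eqOn_of_hasDerivWithinAt_eq (hK : IsCompact K) {u v w : ℝ → ℝ}
    (hu : ∀ x ∈ K, HasDerivWithinAt u (w x) K x) (hv : ∀ x ∈ K, HasDerivWithinAt v (w x) K x)
    (gap : ∀ i : Gap K, u i.right - u i.left = v i.right - v i.left)
    (base : u (sInf K) = v (sInf K)) : EqOn u v K := by
  intro x hx
  have := eq_of_hasDerivWithinAt_zero hK.isClosed (D := u - v)
    (fun z hz => by simpa using (hu z hz).sub (hv z hz))
    (fun i => by simp only [Pi.sub_apply]; linarith [gap i])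
    (hK.sInf_mem ⟨x, hx⟩) hx (csInf_le hK.bddBelow hx)
  simp only [Pi.sub_apply, base, sub_self] at this
  exact sub_eq_zero.1 this

end ClosedSetDerivative

section Glue

variable {m : ℕ} {K : Set ℝ} {F G H : ℕ → ℝ → ℝ}

lemma sub_eq_sub_of_hasDerivAt_eq {u v w : ℝ → ℝ} {a b x : ℝ}
    (hu : ∀ y ∈ Icc a b, HasDerivAt u (w y) y) (hv : ∀ y ∈ Icc a b, HasDerivAt v (w y) y)
    (hx : x ∈ Icc a b) : u x - u a = v x - v a := by
  have hD (y : ℝ) (hy : y ∈ Icc a b) : HasDerivAt (u - v) 0 y := by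
    simpa using (hu y hy).sub (hv y hy)
  rw [sub_eq_sub_iff_sub_eq_sub]
  exact constant_of_has_deriv_right_zero (fun y hy => (hD y hy).continuousAt.continuousWithinAt)
    (fun y hy => (hD y (Ico_subset_Icc_self hy)).hasDerivWithinAt) x hx

lemma exists_derivJet_eq (m : ℕ) {φ : ℝ → ℝ} (hφ : Continuous φ) (a : ℝ) (v : ℕ → ℝ) :
    ∃ f : ℝ → ℝ, ContDiff ℝ m f ∧ derivJet f m = φ ∧ ∀ k < m, derivJet f k a = v k := by
  simp only [derivJet]
  induction m generalizing v with
  | zero => exact ⟨φ, contDiff_zero.2 hφ, iteratedDeriv_zero, fun k hk => absurd hk k.not_lt_zero⟩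
  | succ m ih =>
    obtain ⟨f, hf, top, init⟩ := ih fun k => v (k + 1)
    let P (x : ℝ) : ℝ := v 0 + ∫ t in a..x, f t
    have hP (x : ℝ) : HasDerivAt P (f x) x :=
      (hf.continuous.integral_hasStrictDerivAt a x).hasDerivAt.const_add (v 0)
    have deriv_P : deriv P = f := funext fun x => (hP x).deriv
    refine ⟨P, ?_, by rw [iteratedDeriv_succ', deriv_P, top], fun k hk => ?_⟩
    · rw [Nat.cast_succ, contDiff_succ_iff_deriv, deriv_P]
      exact ⟨fun x => (hP x).differentiableAt, by simp, hf⟩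
    · rcases k with _ | k
      · simp [P]
      · rw [iteratedDeriv_succ', deriv_P, init k (Nat.lt_of_succ_lt_succ hk)]

lemma IsWhitneyField.exists_isExtension (hK : IsCompact K) (hF : IsWhitneyField m K F)
    {Φ : Gap K → ℝ[X]} {c : Gap K → ℝ} (hΦ : ∀ i, IsGapArc m F i.left i.right (c i) (Φ i))
    (hc : Tendsto c cofinite (𝓝 0)) :
    ∃ f, IsExtension m K F f ∧ ∀ i : Gap K, EqOn f (Φ i).eval (Icc i.left i.right) := by
  obtain ⟨φ, hφ, φ_eq, φ_gap⟩ := exists_continuous_patch hK hF.continuousOn_top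
    (fun i => (derivative^[m] (Φ i)).continuous) (fun i => (hΦ i).left m le_rfl)
    (fun i => (hΦ i).right m le_rfl) (fun i => (hΦ i).osc) hc
  obtain ⟨f, hf, top, init⟩ := exists_derivJet_eq m hφ (sInf K) fun k => F k (sInf K)
  suffices agree : ∀ k ≤ m, EqOn (derivJet f k) (F k) K ∧
      ∀ i : Gap K, EqOn (derivJet f k) (derivative^[k] (Φ i)).eval (Icc i.left i.right) from
    ⟨f, ⟨hf, fun k hk => (agree k hk).1⟩, by simpa [derivJet] using (agree 0 (Nat.zero_le m)).2⟩
  intro k hk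
  induction hk using Nat.decreasingInduction with
  | self => exact top ▸ ⟨φ_eq, φ_gap⟩
  | of_succ k hk ih =>
    obtain ⟨ih_K, ih_gap⟩ := ih
    have increment (i : Gap K) (x : ℝ) (hx : x ∈ Icc i.left i.right) :
        derivJet f k x - derivJet f k i.left
          = (derivative^[k] (Φ i)).eval x - (derivative^[k] (Φ i)).eval i.left :=
      sub_eq_sub_of_hasDerivAt_eq (v := (derivative^[k] (Φ i)).eval)
        (fun y _ => hasDerivAt_derivJet hf hk y)
        (fun y hy => (hasDerivAt_iterate_derivative (Φ i) k y).congr_deriv (ih_gap i hy).symm) hx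
    have eq_K : EqOn (derivJet f k) (F k) K :=
      eqOn_of_hasDerivWithinAt_eq hK (w := F (k + 1))
        (fun x hx => ih_K hx ▸ (hasDerivAt_derivJet hf hk x).hasDerivWithinAt)
        (fun x hx => hF.hasDerivWithinAt hk hx)
        (fun i => by rw [increment i _ (right_mem_Icc.2 i.lt.le), (hΦ i).left k hk.le,
          (hΦ i).right k hk.le])
        (init k hk)
    refine ⟨eq_K, fun i x hx => ?_⟩
    have := increment i x hx
    rwa [eq_K i.left_mem, (hΦ i).left k hk.le, sub_left_inj] at this

lemma sweptArea_congr {f g φ ψ : ℝ → ℝ} {a b : ℝ} (hab : a ≤ b) (hf : EqOn f φ (Icc a b))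
    (hg : EqOn g ψ (Icc a b)) : sweptArea f g a b = sweptArea φ ψ a b := by
  refine intervalIntegral.integral_congr_Ioo_of_le hab fun x hx => ?_
  have hI := Icc_mem_nhds hx.1 hx.2
  have hx := Ioo_subset_Icc_self hx
  simp only [hf hx, hg hx, (hf.eventuallyEq_of_mem hI).deriv_eq,
    (hg.eventuallyEq_of_mem hI).deriv_eq]

lemma exists_gapArcs (hm : 1 ≤ m) (hK : IsCompact K) (hF : IsWhitneyField m K F)
    (hG : IsWhitneyField m K G)
    (hA : (fun p => areaDiscrepancy m F G H p.1 p.2) =o[shortIntervals K]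
      fun p => velocity m F G p.1 p.2) :
    ∃ (Φ Ψ : Gap K → ℝ[X]) (c : Gap K → ℝ), Tendsto c cofinite (𝓝 0) ∧
      (∀ i, IsGapArc m F i.left i.right (c i) (Φ i)) ∧
      (∀ i, IsGapArc m G i.left i.right (c i) (Ψ i)) ∧
      ∀ i, 2 * sweptArea (Φ i).eval (Ψ i).eval i.left i.right = H 0 i.right - H 0 i.left := by
  obtain ⟨c, fill, hc⟩ := exists_tendsto_zero (tendsto_gap_length hK.isBounded)
    (fun i => sub_pos.2 i.lt)
    (P := fun i => HasGapFill m F G i.left i.right ((H 0 i.right - H 0 i.left) / 2))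
    (fun i => exists_hasGapFill m F G i.lt _) (fun i c h => h.nonneg i.lt.le)
    (fun η hη => (tendsto_gap_shortIntervals hK.isBounded).eventually
      (eventually_hasGapFill hm hF hG hA hη))
  choose Φ Ψ hΦ hΨ area using fill
  exact ⟨Φ, Ψ, c, hc, hΦ, hΨ, fun i => by rw [area, mul_div_cancel₀ _ two_ne_zero]⟩

theorem exists_horizontal_extension (hm : 1 ≤ m) (hK : IsCompact K) (hF : IsWhitneyField m K F)
    (hG : IsWhitneyField m K G) (hH : IsWhitneyField m K H)
    (hP : ∀ k : ℕ, 1 ≤ k → k ≤ m → ∀ t ∈ K,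
      H k t = MvPolynomial.eval (Sum.elim (fun j => F j t) (fun j => G j t)) (horizPoly k))
    (hA : (fun p => areaDiscrepancy m F G H p.1 p.2) =o[shortIntervals K]
      fun p => velocity m F G p.1 p.2) :
    ∃ f g h, IsExtension m K F f ∧ IsExtension m K G g ∧ IsExtension m K H h ∧
      IsHorizontalLift f g h := by
  obtain ⟨Φ, Ψ, c, hc, hΦ, hΨ, area⟩ := exists_gapArcs hm hK hF hG hA
  obtain ⟨f, hf, f_gap⟩ := hF.exists_isExtension hK hΦ hc
  obtain ⟨g, hg, g_gap⟩ := hG.exists_isExtension hK hΨ hc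
  have hm' : (1 : WithTop ℕ∞) ≤ m := mod_cast hm
  have cf := hf.contDiff.of_le hm'
  have cg := hg.contDiff.of_le hm'
  let h (x : ℝ) : ℝ := H 0 (sInf K) + 2 * sweptArea f g (sInf K) x
  have lift : IsHorizontalLift f g h := fun x =>
    ((hasDerivAt_sweptArea cf cg (sInf K) x).const_mul 2).const_add _
  have eqOn (k : ℕ) (hk : 1 ≤ k) (hkm : k ≤ m) : EqOn (derivJet h k) (H k) K := fun t ht =>
    (lift.eqOn_horizPoly hf hg hk hkm ht).trans (hP k hk hkm t ht).symm
  have ch := lift.contDiff hm hf.contDiff hg.contDiff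
  have eqOn_zero : EqOn (derivJet h 0) (H 0) K := by
    refine eqOn_of_hasDerivWithinAt_eq hK (w := H 1)
      (fun x hx => eqOn 1 le_rfl hm hx ▸ (hasDerivAt_derivJet ch hm x).hasDerivWithinAt)
      (fun x hx => hH.hasDerivWithinAt hm hx) (fun i => ?_) (by simp [derivJet, h, sweptArea])
    simp only [derivJet, iteratedDeriv_zero]
    rw [lift.sub_eq cf cg, sweptArea_congr i.lt.le (f_gap i) (g_gap i), area]
  refine ⟨f, g, h, hf, hg, ⟨ch, fun k hk => ?_⟩, lift⟩
  rcases k.eq_zero_or_pos with rfl | hk₀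
  · exact eqOn_zero
  · exact eqOn k hk₀ hk

end Glue

end HeisWhitney

theorem theorem1p1 (m : ℕ) (hm : 1 ≤ m) (K : Set ℝ) (hK : IsCompact K)
    (F G H : ℕ → ℝ → ℝ)
    (hF : HeisWhitney.IsJet m K F) (hG : HeisWhitney.IsJet m K G)
    (hH : HeisWhitney.IsJet m K H) :
    (∃ f g h : ℝ → ℝ, HeisWhitney.ExtendsTo m K F G H f g h) ↔
      (HeisWhitney.IsWhitneyField m K F ∧ HeisWhitney.IsWhitneyField m K G ∧
        HeisWhitney.IsWhitneyField m K H) ∧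
      (∀ k : ℕ, 1 ≤ k → k ≤ m → ∀ t ∈ K,
        H k t = MvPolynomial.eval (Sum.elim (fun j => F j t) (fun j => G j t))
          (HeisWhitney.horizPoly k)) ∧
      (∀ ε : ℝ, 0 < ε → ∃ δ : ℝ, 0 < δ ∧ ∀ a ∈ K, ∀ b ∈ K, a < b → b - a < δ →
        |HeisWhitney.areaDiscrepancy m F G H a b / HeisWhitney.velocity m F G a b| < ε) := by
  simp only [HeisWhitney.extendsTo_iff hm, ← HeisWhitney.areaDiscrepancy_isLittleO_iff]
  constructor
  · rintro ⟨f, g, h, hf, hg, hh, lift⟩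
    have value : Set.EqOn h (H 0) K := by
      simpa [HeisWhitney.derivJet] using hh.eqOn 0 (Nat.zero_le m)
    exact ⟨⟨hf.isWhitneyField hK.isBounded, hg.isWhitneyField hK.isBounded,
        hh.isWhitneyField hK.isBounded⟩,
      fun k hk hkm t ht => (hh.eqOn k hkm ht).symm.trans (lift.eqOn_horizPoly hf hg hk hkm ht),
      lift.areaDiscrepancy_isLittleO hm hK.isBounded hf hg value⟩
  · rintro ⟨⟨wF, wG, wH⟩, hP, hA⟩
    exact HeisWhitney.exists_horizontal_extension hm hK wF wG wH hP hA
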